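/- **Conventions.** Digraphs are finite, without loops, with at most one arc in each direction between two vertices; paths are directed; "disjoint" means vertex-disjoint; $\log$ is the natural logarithm; $\delta^0(D)$ is the minimum of all in- and out-degrees of $D$. For $0<\nu\le\tau<1$, a digraph $D$ on $n$ vertices is a *robust $(\nu,\tau)$-expander* if for every $S\subseteq V(D)$ with $\tau n<|S|<(1-\tau)n$, at least $|S|+\nu n$ vertices have at least $\nu n$ in-neighbours in $S$, and at least $|S|+\nu n$ vertices have at least $\nu n$ out-neighbours in $S$. An *$H$-subdivision* in $D$ consists of an injective map $f:V(H)\to V(D)$ (its values are the branch vertices) and, for each arc $uv$ of $H$, a path in $D$ from $f(u)$ to $f(v)$ (a subdivided path), such that the paths of distinct arcs are internally disjoint and no path has a branch vertex in its interior. A *ladder* from $v_0$ to $v_0^*$ in $D$ consists, for some $k\ge 0$, of distinct vertices $v_0,\dots,v_{2k},v_{2k}^*,\dots,v_0^*$, the arcs $v_iv_{i+1},\,v_{i+1}^*v_i^*$ for even $i<2k$, the arcs $v_{i+1}v_i,\,v_i^*v_{i+1}^*$ for odd $i<2k$, the arc $v_{2k}v_{2k}^*$, and pairwise disjoint paths $Q_i$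 from $v_i$ to $v_i^*$ for odd $i<2k$, which meet $\{v_0,\dots,v_{2k},v_0^*,\dots,v_{2k}^*\}$ only in their ends. Its *rung paths* are $R_i=v_iv_{i+1}Q_{i+1}v_{i+1}^*v_i^*$ for even $i<2k$, and $R_{2k}=v_{2k}v_{2k}^*$. A ladder is *embedded* in an $H$-subdivision if all its rung paths are subpaths of one and the same subdivided path; it is then said to be embedded in that path. For distinct vertices $x,y,u,v$, the pair $(u,v)$ *covers* $(x,y)$ if $ux$ and $yv$ are arcs. A set $K$ of ordered pairs of vertices *$d$-covers* $V(D)$ if every ordered pair of distinct vertices of $D$ is covered by at least $d$ elements of $K$. Consider triples $(K,\mathcal L,\mathcal H)$ such that (1) $K$ is a set of pairwise disjoint ordered pairs of distinct vertices of $D$ that $d$-covers $V(D)$; (2) $\mathcal L$ is a set of pairwise disjoint ladders in $D$ which contains, for each $(u,v)\in K$, a ladder from $u$ to $v$. Such a triple is a *Type-I $d$-absorber* (for $H$) if $\mathcal H$ is an $H$-subdivision in $D$ in which every ladder of $\mathcal L$ is embedded, and each subdivided path of $\mathcal H$ has at least one ladder of $\mathcal L$ embedded in it. It is a *Type-II $d$-absorber*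 (for $H$) if $\mathcal H$ is a collection of pairwise disjoint $H$-subdivisions in $D$ such that every ladder of $\mathcal L$ is embedded in a member of $\mathcal H$, and every member of $\mathcal H$ has at least one ladder of $\mathcal L$ embedded in it. The vertex set of an absorber consists of all vertices of its pairs, its ladders and its $H$-subdivisions. **Lemma.** Let $0<\nu\le\tau\le\gamma/16<1/16$, let $d\ge 8$ and $n$ be integers with $$n>\max\{10^4d^2\gamma^{-5}\log^2(100d\gamma^{-2}),\ 10^5d\gamma^{-2}\nu^{-3}\log(1500d\gamma^{-2}\nu^{-1})\},$$ and let $H$ be a non-empty digraph without isolated vertices with $h$ arcs, where $$h\le \gamma^{-2}\bigl(d\log(d\gamma^{-2})+\log n\bigr).$$ Let $D$ be an $n$-vertex robust $(\nu,\tau)$-expander with $\delta^0(D)\ge\gamma n$. Then the following hold. (I) For every injective map $f:V(H)\to V(D)$, $D$ contains a Type-I $d$-absorber for $H$ whose $H$-subdivision sends each vertex $w$ of $H$ to $f(w)$. (II) For every integer $k\ge1$ with $kh\le \gamma^{-2}(d\log(d\gamma^{-2})+\log n)$, $D$ contains a Type-II $d$-absorber for $H$ with exactly $k$ $H$-subdivisions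 (in particular for $k=1$). All these absorbers can be chosen with at most $$1600\,\nu^{-2}\gamma^{-2}\bigl(d\log(d\gamma^{-2})+\log n\bigr)+3\nu^{-2}d$$ vertices. -/

import Mathlib

universe u v

noncomputable section

namespace HLinkage

variable {V : Type u} {W : Type v}

/-! ### Digraphs: arcs, degrees, paths

A digraph is a `Digraph` (so there is at most one arc in each direction between two vertices)
without loops. -/

/-- A digraph has no loops. -/
def Loopless (D : Digraph V) : Prop := ∀ x, ¬ D.Adj x x

/-- Every vertex is the tail or the head of some arc. -/
def NoIsolatedVertices (D : Digraph V) : Prop := ∀ x, ∃ y, D.Adj x y ∨ D.Adj y x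

/-- The type of arcs of a digraph; the arc `e` goes from `e.1.1` to `e.1.2`. -/
abbrev Arc (D : Digraph V) : Type u := {e : V × V // D.Adj e.1 e.2}

/-- The out-degree of `x`. -/
def outDegree (D : Digraph V) (x : V) : ℕ := {y | D.Adj x y}.ncard

/-- The in-degree of `x`. -/
def inDegree (D : Digraph V) (x : V) : ℕ := {y | D.Adj y x}.ncard

/-- The minimum semi-degree (the minimum of all out-degrees and all in-degrees). -/
def minSemidegree (D : Digraph V) : ℕ := ⨅ x, min (outDegree D x) (inDegree D x)

/-- `l` lists the vertices, in order, of a directed path of `D` from `a` to `b`. -/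
structure IsPath (D : Digraph V) (a b : V) (l : List V) : Prop where
  chain : l.IsChain D.Adj
  nodup : l.Nodup
  head : l.head? = some a
  last : l.getLast? = some b

/-! ### Robust expanders -/

/-- The `ν`-robust out-neighbourhood of `S`: the vertices with at least `ν|V|` in-neighbours
in `S`. -/
def robustOutNbhd (D : Digraph V) (ν : ℝ) (S : Set V) : Set V :=
  {x | ν * Nat.card V ≤ ({y | y ∈ S ∧ D.Adj y x}.ncard : ℝ)}

/-- The `ν`-robust in-neighbourhood of `S`: the vertices with at least `ν|V|` out-neighbours
in `S`. -/
def robustInNbhd (D : Digraph V) (ν : ℝ) (S : Set V) : Set V :=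
  {x | ν * Nat.card V ≤ ({y | y ∈ S ∧ D.Adj x y}.ncard : ℝ)}

def IsRobustOutexpander (D : Digraph V) (ν τ : ℝ) : Prop :=
  ∀ S : Set V, τ * Nat.card V < S.ncard → (S.ncard : ℝ) < (1 - τ) * Nat.card V →
    (S.ncard : ℝ) + ν * Nat.card V ≤ (robustOutNbhd D ν S).ncard

def IsRobustInexpander (D : Digraph V) (ν τ : ℝ) : Prop :=
  ∀ S : Set V, τ * Nat.card V < S.ncard → (S.ncard : ℝ) < (1 - τ) * Nat.card V →
    (S.ncard : ℝ) + ν * Nat.card V ≤ (robustInNbhd D ν S).ncard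

def IsRobustExpander (D : Digraph V) (ν τ : ℝ) : Prop :=
  IsRobustInexpander D ν τ ∧ IsRobustOutexpander D ν τ

/-! ### Subdivisions -/

/-- An `H`-subdivision in `D`: an injective map `branch` on the vertices of `H`, and for every
arc `xy` of `H` a path of `D` from `branch x` to `branch y`, such that the paths of distinct arcs
are internally vertex-disjoint, and no path has a branch vertex in its interior. -/
structure Subdivision (H : Digraph W) (D : Digraph V) where
  branch : W → V
  branch_injective : Function.Injective branch
  path : Arc H → List V
  isPath : ∀ e, IsPath D (branch e.1.1) (branch e.1.2) (path e)
  branch_mem : ∀ e w, branch w ∈ path e → w = e.1.1 ∨ w = e.1.2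
  disjoint : ∀ e e', e ≠ e' → ∀ x ∈ path e, x ∈ path e' → x ∈ Set.range branch

/-- The vertex set of an `H`-subdivision. -/
def Subdivision.verts {H : Digraph W} {D : Digraph V} (S : Subdivision H D) : Set V :=
  Set.range S.branch ∪ {x | ∃ e, x ∈ S.path e}

/-! ### Ladders -/

/-- A ladder of `D`. In terms of the spine `v_0 v_1 ⋯ v_{2k} v*_{2k} ⋯ v*_1 v*_0`,
`ev j` is `v_{2j}`, `od j` is `v_{2j+1}`, `evS j` is `v*_{2j}` and `odS j` is `v*_{2j+1}`.
The spine is an alternating path: the arcs are `v_i v_{i+1}` and `v*_{i+1} v*_i` for even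
`i < 2k`, `v_{i+1} v_i` and `v*_i v*_{i+1}` for odd `i < 2k`, and `v_{2k} v*_{2k}`.
`Q j` is the directed path from `v_{2j+1}` to `v*_{2j+1}`; these paths are pairwise disjoint and
internally disjoint from the spine. -/
structure Ladder (D : Digraph V) where
  k : ℕ
  ev : Fin (k + 1) → V
  od : Fin k → V
  evS : Fin (k + 1) → V
  odS : Fin k → V
  spine_injective : Function.Injective (Sum.elim (Sum.elim ev od) (Sum.elim evS odS))
  adj_ev_od : ∀ j : Fin k, D.Adj (ev j.castSucc) (od j)
  adj_odS_evS : ∀ j : Fin k, D.Adj (odS j) (evS j.castSucc)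
  adj_succ_od : ∀ j : Fin k, D.Adj (ev j.succ) (od j)
  adj_odS_succ : ∀ j : Fin k, D.Adj (odS j) (evS j.succ)
  adj_last : D.Adj (ev (Fin.last k)) (evS (Fin.last k))
  Q : Fin k → List V
  isPath_Q : ∀ j, IsPath D (od j) (odS j) (Q j)
  Q_disjoint : ∀ i j, i ≠ j → List.Disjoint (Q i) (Q j)
  Q_spine : ∀ j, ∀ x ∈ Q j,
    x ∈ Set.range (Sum.elim (Sum.elim ev od) (Sum.elim evS odS)) → x = od j ∨ x = odS j

namespace Ladder

variable {D : Digraph V}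

/-- The vertex set of a ladder. -/
def verts (L : Ladder D) : Set V :=
  Set.range (Sum.elim (Sum.elim L.ev L.od) (Sum.elim L.evS L.odS)) ∪ {x | ∃ j, x ∈ L.Q j}

/-- `L` is a ladder from `a` to `b`. -/
def FromTo (L : Ladder D) (a b : V) : Prop := L.ev 0 = a ∧ L.evS 0 = b

/-- The rung path `R_{2j} = v_{2j} v_{2j+1} Q_{2j+1} v*_{2j+1} v*_{2j}`, for `j < k`. -/
def rung (L : Ladder D) (j : Fin L.k) : List V :=
  L.ev j.castSucc :: (L.Q j ++ [L.evS j.castSucc])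

/-- The rung path `R_{2k} = v_{2k} v*_{2k}`. -/
def lastRung (L : Ladder D) : List V := [L.ev (Fin.last L.k), L.evS (Fin.last L.k)]

/-- All rung paths of `L` are subpaths of the subdivided path of the arc `e`. -/
def EmbeddedInPath {H : Digraph W} (L : Ladder D) (S : Subdivision H D) (e : Arc H) : Prop :=
  (∀ j, L.rung j <:+: S.path e) ∧ L.lastRung <:+: S.path e

/-- `L` is embedded in the `H`-subdivision `S`: all rung paths of `L` are subpaths of one and the
same subdivided path of `S`. -/
def Embedded {H : Digraph W} (L : Ladder D) (S : Subdivision H D) : Prop :=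
  ∃ e : Arc H, L.EmbeddedInPath S e

end Ladder

/-! ### Absorbers -/

/-- For distinct vertices `x, y, u, v`, the pair `(u, v)` covers `(x, y)` if `ux` and `yv` are
arcs. -/
def Covers (D : Digraph V) (p q : V × V) : Prop :=
  [p.1, p.2, q.1, q.2].Nodup ∧ D.Adj p.1 q.1 ∧ D.Adj q.2 p.2

/-- `K` `d`-covers `V(D)`: every ordered pair of distinct vertices is covered by at least `d`
elements of `K`. -/
def DCovers (D : Digraph V) (d : ℕ) (K : Set (V × V)) : Prop :=
  ∀ x y : V, x ≠ y → ∃ T : Finset (V × V), T.card = d ∧ ∀ p ∈ T, p ∈ K ∧ Covers D p (x, y)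

/-- `K` is a set of pairwise disjoint ordered pairs of distinct vertices. -/
def DisjointPairs (K : Set (V × V)) : Prop :=
  (∀ p ∈ K, p.1 ≠ p.2) ∧
    ∀ p ∈ K, ∀ q ∈ K, p ≠ q → Disjoint ({p.1, p.2} : Set V) {q.1, q.2}

/-- The part common to both types of absorbers: `K` is a set of disjoint ordered pairs that
`d`-covers `V(D)`, and `Ls` is a set of disjoint ladders that contains, for each pair `(a, b)` in
`K`, a ladder from `a` to `b`. -/
structure IsAbsorberBase (D : Digraph V) (d : ℕ) (K : Set (V × V)) (Ls : Set (Ladder D)) :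
    Prop where
  disjointPairs : DisjointPairs K
  dCovers : DCovers D d K
  ladders_disjoint : ∀ L ∈ Ls, ∀ L' ∈ Ls, L ≠ L' → Disjoint L.verts L'.verts
  exists_ladder : ∀ p ∈ K, ∃ L ∈ Ls, L.FromTo p.1 p.2

/-- `(K, Ls, S)` is a Type-I `d`-absorber: each ladder is embedded in the `H`-subdivision `S`,
and each subdivided path of `S` contains at least one embedded ladder. -/
structure IsTypeIAbsorber {H : Digraph W} {D : Digraph V} (d : ℕ) (K : Set (V × V))
    (Ls : Set (Ladder D)) (S : Subdivision H D) : Prop where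
  base : IsAbsorberBase D d K Ls
  embedded : ∀ L ∈ Ls, L.Embedded S
  path_has_ladder : ∀ e : Arc H, ∃ L ∈ Ls, L.EmbeddedInPath S e

/-- `(K, Ls, Hs)` is a Type-II `d`-absorber: `Hs` is a collection of disjoint `H`-subdivisions,
each ladder is embedded in a member of `Hs`, and each member of `Hs` has at least one embedded
ladder. -/
structure IsTypeIIAbsorber {H : Digraph W} {D : Digraph V} (d : ℕ) (K : Set (V × V))
    (Ls : Set (Ladder D)) (Hs : Set (Subdivision H D)) : Prop where
  base : IsAbsorberBase D d K Ls
  subdivisions_disjoint : ∀ S ∈ Hs, ∀ S' ∈ Hs, S ≠ S' → Disjoint S.verts S'.verts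
  embedded : ∀ L ∈ Ls, ∃ S ∈ Hs, L.Embedded S
  has_ladder : ∀ S ∈ Hs, ∃ L ∈ Ls, L.Embedded S

/-- The vertex set of an absorber: all vertices of its pairs, its ladders and its
`H`-subdivisions (for Type I there is one `H`-subdivision). -/
def absorberVerts {H : Digraph W} {D : Digraph V} (K : Set (V × V)) (Ls : Set (Ladder D))
    (Hs : Set (Subdivision H D)) : Set V :=
  {x | ∃ p ∈ K, x = p.1 ∨ x = p.2} ∪ (⋃ L ∈ Ls, L.verts) ∪ ⋃ S ∈ Hs, S.verts

/-- The bound `1600 ν⁻² γ⁻² (d log (d γ⁻²) + log n) + 3 ν⁻² d`. -/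
def absorberBound (n d : ℕ) (ν γ : ℝ) : ℝ :=
  1600 * (ν ^ 2)⁻¹ * (γ ^ 2)⁻¹ * (d * Real.log (d * (γ ^ 2)⁻¹) + Real.log n)
    + 3 * (ν ^ 2)⁻¹ * d

end HLinkage

end

/-!
All choices in this proof are deterministic and greedy; the bounds leave ample room for that. Put
`m = γ⁻² (d log (d γ⁻²) + log n)`. The lower bound on `n` gives `100 ν⁻³ m ≤ n`, so everything
that is constructed, about `ν⁻² m` vertices up to a constant, stays below `ν n` vertices.

*Linkage.* For any prescribed sequence of arc directions, the set of vertices robustly reached from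
a vertex `a` starts with `γ n > τ n` vertices and grows by `ν n` in every step, until it misses at
most `τ n` vertices; from the next step on it is everything, as all degrees are at least
`γ n ≥ τ n + ν n`. So every length from `ℓ = ⌈1 / ν⌉ + 2` on is possible, and the walk can be chosen
backwards with `ν n` choices for each inner vertex, hence with distinct inner vertices outside any
given set of fewer than about `ν n` vertices (`IsRobustExpander.flexiblyLinked`). Directed paths and
the alternating spines of ladders are both special cases.

*Covering pairs.* Give a pair of distinct vertices the weight `2⁻ᶜ`, where `c` is the number of
pairs chosen so far that cover it. Averaged over the disjoint pairs still available, a new pair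
lowers the total weight by the factor `1 - γ² / 4`, so after `⌈8 m⌉` pairs the total is at most
`2⁻ᵈ`, and every pair is covered `d` times (`exists_disjointPairs_dCovers`).

*Absorbers.* The pairs are extended to disjoint ladders (`FlexiblyLinked.exists_ladders`), the
ladders are distributed over the arcs of `H` so that every arc gets at least one, and the path of
each arc is joined from the rungs of its ladders (`FlexiblyLinked.exists_subdivision`). This gives
Type-I absorbers for any branch vertices. A Type-II absorber with `k` subdivisions of `H` comes from
a Type-I absorber for `k` disjoint copies of `H`, with arbitrary branch vertices
(`IsTypeIAbsorber.isTypeIIAbsorber`).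
-/

namespace HLinkage

/-! ### Walks with prescribed arc directions in a robust expander -/

/-- `Step D b x y` holds if `xy` is an arc (for `b = true`) or `yx` is an arc (for `b = false`). -/
def Step {V : Type u} (D : Digraph V) (b : Bool) (x y : V) : Prop :=
  bif b then D.Adj x y else D.Adj y x

/-- `D` is linked with flexible directions, from length `ℓ` on and within the capacity `B`: for
every prescribed sequence `σ` of arc directions, any two vertices are joined by a walk of every
length `L ≥ ℓ` that follows `σ`, whose inner vertices are distinct and avoid a given set `X`,
provided that `|X| + L ≤ B`. -/
def FlexiblyLinked {V : Type u} (D : Digraph V) (ℓ B : ℕ) : Prop :=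
  ∀ (σ : ℕ → Bool) (a b : V) (L : ℕ) (X : Finset V), ℓ ≤ L → X.card + L ≤ B →
    ∃ x : ℕ → V, x 0 = a ∧ x L = b ∧ (∀ t < L, Step D (σ t) (x t) (x (t + 1))) ∧
      (∀ t, 0 < t → t < L → x t ∉ X) ∧ Set.InjOn x (Set.Ioo 0 L)

/-- If every vertex of the layer `A (t + 1)` has at least `c` predecessors in the layer `A t`, then
a walk through the layers can be chosen backwards from its end, each time avoiding the set `X` and
the vertices chosen before. -/
theorem exists_walk_through_layers {V : Type u} [Finite V] (R : ℕ → V → V → Prop) (A : ℕ → Set V)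
    (c : ℝ) (a : V) (hA0 : ∀ x ∈ A 0, R 0 a x)
    (hA : ∀ t, ∀ x ∈ A (t + 1), c ≤ ({y | y ∈ A t ∧ R (t + 1) y x}.ncard : ℝ)) (L : ℕ) :
    ∀ b ∈ A L, ∀ X : Finset V, (X.card + (L + 1) : ℝ) ≤ c →
      ∃ x : ℕ → V, x 0 = a ∧ x (L + 1) = b ∧ (∀ t < L + 1, R t (x t) (x (t + 1))) ∧
        (∀ t, 0 < t → t < L + 1 → x t ∉ X) ∧ Set.InjOn x (Set.Ioo 0 (L + 1)) := by
  classical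
  induction L with
  | zero =>
    intro b hb X _
    refine ⟨fun t => if t = 0 then a else b, by simp, by simp, ?_, ?_, ?_⟩
    · intro t ht
      obtain rfl : t = 0 := by omega
      simpa using hA0 b hb
    · intro t h0 h1; omega
    · intro s hs; have := hs.1; have := hs.2; omega
  | succ L ih =>
    intro b hb X hX
    have h1 := hA L b hb
    obtain ⟨y, hy, hyX⟩ : ∃ y ∈ {y | y ∈ A L ∧ R (L + 1) y b}, y ∉ (X : Set V) := by
      refine Set.exists_mem_notMem_of_ncard_lt_ncard ?_ X.finite_toSet
      rw [Set.ncard_coe_finset]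
      push_cast at hX
      have : (X.card : ℝ) < ({y | y ∈ A L ∧ R (L + 1) y b}.ncard : ℝ) := by
        have : (0 : ℝ) ≤ L := L.cast_nonneg
        linarith
      exact_mod_cast this
    have hyX' : y ∉ X := by simpa using hyX
    obtain ⟨x, hx0, hxL, hxR, hxX, hinj⟩ := ih y hy.1 (insert y X) (by
      rw [Finset.card_insert_of_notMem hyX']; push_cast at hX ⊢; linarith)
    refine ⟨Function.update x (L + 1 + 1) b, ?_, by simp, ?_, ?_, ?_⟩
    · rw [Function.update_of_ne (by omega)]; exact hx0
    · intro t ht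
      rw [Function.update_of_ne (by omega)]
      rcases Nat.lt_succ_iff_lt_or_eq.mp ht with h | h
      · rw [Function.update_of_ne (by omega)]; exact hxR t h
      · subst h; rw [Function.update_self, hxL]; exact hy.2
    · intro t h0 h1
      rw [Function.update_of_ne (by omega)]
      rcases Nat.lt_succ_iff_lt_or_eq.mp h1 with h | h
      · exact fun hm => hxX t h0 h (Finset.mem_insert_of_mem hm)
      · subst h; rw [hxL]; exact hyX'
    · have key : ∀ t, 0 < t → t < L + 1 → x t ≠ y := fun t h0 h1 he =>
        hxX t h0 h1 (he ▸ Finset.mem_insert_self _ _)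
      intro s hs t ht hst
      obtain ⟨hs0, hs1⟩ := hs
      obtain ⟨ht0, ht1⟩ := ht
      rw [Function.update_of_ne (by omega), Function.update_of_ne (by omega)] at hst
      rcases Nat.lt_succ_iff_lt_or_eq.mp hs1 with h | h <;>
        rcases Nat.lt_succ_iff_lt_or_eq.mp ht1 with h' | h'
      · exact hinj ⟨hs0, h⟩ ⟨ht0, h'⟩ hst
      · subst h'; rw [hxL] at hst; exact absurd hst (key s hs0 h)
      · subst h; rw [hxL] at hst; exact absurd hst.symm (key t ht0 h')
      · omega

/-- The vertices that can be robustly reached from `a` by a walk of length `t + 1` that follows the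
direction pattern `σ`: the neighbourhood of `a` for `t = 0`, and the robust neighbourhood of the
preceding layer for larger `t`. -/
def reachLayer {V : Type u} (D : Digraph V) (ν : ℝ) (σ : ℕ → Bool) (a : V) : ℕ → Set V
  | 0 => {x | Step D (σ 0) a x}
  | t + 1 => {x | ν * Nat.card V ≤
      ({y | y ∈ reachLayer D ν σ a t ∧ Step D (σ (t + 1)) y x}.ncard : ℝ)}

theorem IsRobustExpander.le_ncard {V : Type u} {D : Digraph V} {ν τ : ℝ}
    (h : IsRobustExpander D ν τ) (b : Bool) (S : Set V) (h1 : τ * Nat.card V < S.ncard)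
    (h2 : (S.ncard : ℝ) < (1 - τ) * Nat.card V) :
    (S.ncard : ℝ) + ν * Nat.card V ≤
      ({x | ν * Nat.card V ≤ ({y | y ∈ S ∧ Step D b y x}.ncard : ℝ)}.ncard : ℝ) := by
  cases b
  · exact h.1 S h1 h2
  · exact h.2 S h1 h2

/-- A robust expander of large minimum semidegree is flexibly linked: the layers reached from a
vertex grow by `ν n` in each step until they miss at most `τ n` vertices, and then the next layer
is everything since all degrees exceed `τ n + ν n`. -/
theorem IsRobustExpander.flexiblyLinked {V : Type u} [Finite V] {D : Digraph V} {ν τ γ : ℝ}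
    (h : IsRobustExpander D ν τ) (hν : 0 < ν) (hντ : ν ≤ τ) (hτγ : τ ≤ γ / 16)
    (hdeg : ∀ b x, γ * Nat.card V ≤ ({y | Step D b x y}.ncard : ℝ)) (ℓ B : ℕ)
    (hℓ : 1 / ν + 2 ≤ ℓ) (hB : (B : ℝ) ≤ ν * Nat.card V) : FlexiblyLinked D ℓ B := by
  intro σ a b L X hL hX
  set n : ℝ := ((Nat.card V : ℕ) : ℝ) with hn
  have hn0 : 0 < n := by
    have : Nonempty V := ⟨a⟩
    rw [hn]; exact_mod_cast Nat.card_pos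
  have hfull : ∀ (t : ℕ), (1 - τ) * n ≤ ((reachLayer D ν σ a t).ncard : ℝ) →
      ∀ x, x ∈ reachLayer D ν σ a (t + 1) := by
    intro t ht x
    have hc : ((reachLayer D ν σ a t)ᶜ.ncard : ℝ) ≤ τ * n := by
      have := Set.ncard_add_ncard_compl (reachLayer D ν σ a t)
      have h' : ((reachLayer D ν σ a t).ncard : ℝ) + ((reachLayer D ν σ a t)ᶜ.ncard : ℝ) = n := by
        rw [hn]; exact_mod_cast this
      linarith
    have hsub : {y | Step D (!σ (t + 1)) x y} ⊆
        {y | y ∈ reachLayer D ν σ a t ∧ Step D (σ (t + 1)) y x} ∪ (reachLayer D ν σ a t)ᶜ := by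
      intro y hy
      by_cases hm : y ∈ reachLayer D ν σ a t
      · left
        refine ⟨hm, ?_⟩
        revert hy
        cases σ (t + 1) <;> exact id
      · right; exact hm
    have h1 : ({y | Step D (!σ (t + 1)) x y}.ncard : ℝ) ≤
        ({y | y ∈ reachLayer D ν σ a t ∧ Step D (σ (t + 1)) y x}.ncard : ℝ)
          + ((reachLayer D ν σ a t)ᶜ.ncard : ℝ) := by
      exact_mod_cast (Set.ncard_le_ncard hsub).trans (Set.ncard_union_le _ _)
    have h2 := hdeg (!σ (t + 1)) x
    show ν * n ≤ _
    nlinarith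
  have hgrow : ∀ t : ℕ, min ((1 - τ) * n) (γ * n + t * (ν * n)) ≤
      ((reachLayer D ν σ a t).ncard : ℝ) := by
    intro t
    induction t with
    | zero => exact (min_le_right _ _).trans (by simpa [reachLayer] using hdeg (σ 0) a)
    | succ t ih =>
      by_cases hc : (1 - τ) * n ≤ ((reachLayer D ν σ a t).ncard : ℝ)
      · have hu : reachLayer D ν σ a (t + 1) = Set.univ := Set.eq_univ_of_forall (hfull t hc)
        rw [hu, Set.ncard_univ]
        exact (min_le_left _ _).trans (by nlinarith)
      · push Not at hc
        have h1 : γ * n + t * (ν * n) ≤ ((reachLayer D ν σ a t).ncard : ℝ) := by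
          rcases min_le_iff.mp ih with h' | h'
          · linarith
          · exact h'
        have h0 : (0 : ℝ) ≤ t * (ν * n) := by positivity
        have h2 := h.le_ncard (σ (t + 1)) (reachLayer D ν σ a t) (by nlinarith) hc
        refine (min_le_right _ _).trans ?_
        push_cast
        change _ ≤ (({x | ν * Nat.card V ≤
          ({y | y ∈ reachLayer D ν σ a t ∧ Step D (σ (t + 1)) y x}.ncard : ℝ)}).ncard : ℝ)
        linarith
  have hL2 : 1 / ν + 2 ≤ (L : ℝ) := hℓ.trans (by exact_mod_cast hL)
  have hν1 : 0 < 1 / ν := by positivity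
  obtain ⟨t, rfl⟩ : ∃ t, L = t + 2 := ⟨L - 2, by
    have : (2 : ℝ) ≤ L := by linarith
    have : 2 ≤ L := by exact_mod_cast this
    omega⟩
  have ht : 1 / ν ≤ (t : ℝ) := by push_cast at hL2; linarith
  have htn : n ≤ t * (ν * n) := by
    have : 1 ≤ t * ν := by rwa [div_le_iff₀ hν] at ht
    nlinarith
  refine exists_walk_through_layers (fun t => Step D (σ t)) (reachLayer D ν σ a) (ν * n) a
    (fun x hx => hx) (fun t x hx => hx) (t + 1) b (hfull t ?_ b) X ?_
  · have := hgrow t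
    rwa [min_eq_left (by nlinarith)] at this
  · refine le_trans ?_ hB
    exact_mod_cast hX

/-- The directed case of flexible linkage: the two ends with the inner vertices in between form a
directed walk. -/
theorem FlexiblyLinked.exists_chain {V : Type u} {D : Digraph V} {ℓ B : ℕ}
    (h : FlexiblyLinked D ℓ B) (hℓ : 1 ≤ ℓ) (a b : V) (X : Finset V) (hX : X.card + ℓ ≤ B) :
    ∃ l : List V, (a :: (l ++ [b])).IsChain D.Adj ∧ l.Nodup ∧ (∀ x ∈ l, x ∉ X) ∧
      l.length ≤ ℓ := by
  obtain ⟨x, hx0, hxL, hxR, hxX, hinj⟩ := h (fun _ => true) a b ℓ X le_rfl hX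
  have hl : a :: ((List.range (ℓ - 1)).map (fun t => x (t + 1)) ++ [b]) =
      (List.range (ℓ + 1)).map x := by
    obtain ⟨m, rfl⟩ : ∃ m, ℓ = m + 1 := ⟨ℓ - 1, by omega⟩
    rw [List.range_succ, List.map_append, List.range_succ_eq_map]
    simp [hx0, hxL, Function.comp_def]
  refine ⟨(List.range (ℓ - 1)).map (fun t => x (t + 1)), ?_, ?_, ?_, by simp⟩
  · rw [hl, List.isChain_iff_getElem]
    intro i hi
    simp only [List.length_map, List.length_range] at hi
    simpa [Step] using hxR i (by omega)
  · refine List.Nodup.map_on ?_ List.nodup_range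
    intro s hs t ht hst
    rw [List.mem_range] at hs ht
    have := hinj (x₁ := s + 1) (x₂ := t + 1) ⟨by omega, by omega⟩ ⟨by omega, by omega⟩ hst
    omega
  · intro y hy
    obtain ⟨t, ht, rfl⟩ := List.mem_map.mp hy
    rw [List.mem_range] at ht
    exact hxX _ (by omega) (by omega)

/-- Greedy choice of disjoint sets: if a set as required by `P i`, of size at most `c i`, can always
be found outside any superset of `X` that leaves room for it within the capacity `B`, and the total
fits, then disjoint sets can be chosen for all `i`. -/
theorem exists_pairwiseDisjoint_family {ι : Type*} {V : Type u} (s : Finset ι)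
    (P : ι → Finset V → Prop) (c : ι → ℕ) (B : ℕ) (X : Finset V)
    (h : ∀ i ∈ s, ∀ X' : Finset V, X ⊆ X' → X'.card + c i ≤ B →
      ∃ Y, P i Y ∧ Disjoint Y X' ∧ Y.card ≤ c i)
    (hX : X.card + ∑ i ∈ s, c i ≤ B) :
    ∃ Y : ι → Finset V, (∀ i ∈ s, P i (Y i) ∧ Disjoint (Y i) X ∧ (Y i).card ≤ c i) ∧
      ∀ i ∈ s, ∀ j ∈ s, i ≠ j → Disjoint (Y i) (Y j) := by
  classical
  induction s using Finset.induction_on generalizing X with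
  | empty => exact ⟨fun _ => ∅, by simp, by simp⟩
  | insert i s his ih =>
    rw [Finset.sum_insert his] at hX
    obtain ⟨Y₀, hP, hd, hc⟩ := h i (Finset.mem_insert_self _ _) X subset_rfl (by omega)
    obtain ⟨Y, hY, hYd⟩ := ih (X ∪ Y₀)
      (fun j hj X' hX' => h j (Finset.mem_insert_of_mem hj) X'
        (Finset.subset_union_left.trans hX')) (by
      have := Finset.card_union_le X Y₀
      omega)
    have hne : ∀ j ∈ s, j ≠ i := fun j hj e => his (e ▸ hj)
    refine ⟨Function.update Y i Y₀, ?_, ?_⟩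
    · intro j hj
      rcases Finset.mem_insert.mp hj with rfl | hj
      · simpa using ⟨hP, hd, hc⟩
      · rw [Function.update_of_ne (hne j hj)]
        obtain ⟨h1, h2, h3⟩ := hY j hj
        exact ⟨h1, (Finset.disjoint_union_right.mp h2).1, h3⟩
    · intro j hj j' hj' hjj'
      rw [Finset.mem_insert] at hj hj'
      rcases hj with rfl | hj <;> rcases hj' with rfl | hj'
      · exact absurd rfl hjj'
      · rw [Function.update_self, Function.update_of_ne (hne j' hj')]
        exact (Finset.disjoint_union_right.mp (hY j' hj').2.1).2.symm
      · rw [Function.update_self, Function.update_of_ne (hne j hj)]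
        exact (Finset.disjoint_union_right.mp (hY j hj).2.1).2
      · rw [Function.update_of_ne (hne j hj), Function.update_of_ne (hne j' hj')]
        exact hYd j hj j' hj' hjj'

/-! ### Ladders and their rungs -/

theorem isPath_of_isChain {V : Type u} {D : Digraph V} {a b : V} {l : List V}
    (h : (a :: (l ++ [b])).IsChain D.Adj) (hl : l.Nodup) (ha : a ∉ l) (hb : b ∉ l) (hab : a ≠ b) :
    IsPath D a b (a :: (l ++ [b])) where
  chain := h
  nodup := by
    simp only [List.nodup_cons, List.mem_append, List.mem_singleton, List.nodup_append,
      List.nodup_nil, not_or]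
    exact ⟨⟨ha, hab⟩, hl, by simp, fun x hx y hy => by rintro rfl; exact hb (hy ▸ hx)⟩
  head := rfl
  last := by rw [← List.cons_append, List.getLast?_append]; rfl

/-- Ladders exist in flexibly linked digraphs: the spine is a walk of length `4 k + 1` whose arcs
alternate in direction, and the paths `Q j` are then found one after the other. -/
theorem FlexiblyLinked.exists_ladder {V : Type u} {D : Digraph V} {ℓ B : ℕ}
    (h : FlexiblyLinked D ℓ B) (hℓ : 1 ≤ ℓ) (k : ℕ) (hk : ℓ ≤ 4 * k + 1) {a b : V} (hab : a ≠ b)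
    (X : Finset V) (ha : a ∈ X) (hb : b ∈ X) (hX : X.card + (4 * k + 2 + k * ℓ) ≤ B) :
    ∃ Y : Finset V, (∃ L : Ladder D, L.k = k ∧ L.FromTo a b ∧ L.verts ⊆ {a, b} ∪ (Y : Set V)) ∧
      Disjoint Y X ∧ Y.card ≤ 4 * k + 2 + k * ℓ := by
  classical
  obtain ⟨x, hx0, hxL, hxR, hxX, hinj⟩ := h (fun t => t % 2 == 0) a b (4 * k + 1) X hk (by omega)
  have hinj' : ∀ s t, s ≤ 4 * k + 1 → t ≤ 4 * k + 1 → x s = x t → s = t := by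
    have key : ∀ s t, s < t → t ≤ 4 * k + 1 → x s ≠ x t := by
      intro s t hst ht he
      rcases Nat.eq_zero_or_pos s with rfl | hs
      · rcases eq_or_lt_of_le ht with rfl | ht
        · exact hab (by rw [← hx0, ← hxL, he])
        · exact hxX t hst ht (by rw [← he, hx0]; exact ha)
      · rcases eq_or_lt_of_le ht with rfl | ht
        · exact hxX s hs hst (by rw [he, hxL]; exact hb)
        · exact hst.ne (hinj ⟨hs, by omega⟩ ⟨by omega, ht⟩ he)
    intro s t hs ht he
    rcases lt_trichotomy s t with h' | h' | h'
    · exact absurd he (key s t h' ht)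
    · exact h'
    · exact absurd he.symm (key t s h' hs)
  have hfwd : ∀ t, t < 4 * k + 1 → t % 2 = 0 → D.Adj (x t) (x (t + 1)) := by
    intro t ht h0; simpa [Step, h0] using hxR t ht
  have hbwd : ∀ t, t < 4 * k + 1 → t % 2 = 1 → D.Adj (x (t + 1)) (x t) := by
    intro t ht h0; simpa [Step, h0] using hxR t ht
  set Z : Finset V := (Finset.Ioo 0 (4 * k + 1)).image x with hZ
  have hZc : Z.card ≤ 4 * k := Finset.card_image_le.trans (by simp)
  have hmemZ : ∀ t, 0 < t → t < 4 * k + 1 → x t ∈ Z := fun t h0 h1 =>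
    Finset.mem_image_of_mem _ (Finset.mem_Ioo.mpr ⟨h0, h1⟩)
  have hmem : ∀ t, t ≤ 4 * k + 1 → x t ∈ X ∪ Z := by
    intro t ht
    rcases Nat.eq_zero_or_pos t with rfl | h0
    · rw [hx0]; exact Finset.mem_union_left _ ha
    · rcases eq_or_lt_of_le ht with rfl | h1
      · rw [hxL]; exact Finset.mem_union_left _ hb
      · exact Finset.mem_union_right _ (hmemZ t h0 h1)
  have hXZ : (X ∪ Z).card ≤ X.card + 4 * k := (Finset.card_union_le _ _).trans (by omega)
  obtain ⟨Y, hY, hYd⟩ := exists_pairwiseDisjoint_family (Finset.univ : Finset (Fin k))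
    (fun j Y => ∃ l : List V,
      (x (2 * j + 1) :: (l ++ [x (4 * k - 2 * j)])).IsChain D.Adj ∧ l.Nodup ∧ l.toFinset = Y)
    (fun _ => ℓ) B (X ∪ Z) (by
      intro j _ X' _ hX'
      obtain ⟨l, h1, h2, h3, h4⟩ := h.exists_chain hℓ (x (2 * j + 1)) (x (4 * k - 2 * j)) X' hX'
      refine ⟨l.toFinset, ⟨l, h1, h2, rfl⟩, ?_, (List.toFinset_card_le l).trans h4⟩
      rw [Finset.disjoint_left]
      intro y hy
      exact h3 y (List.mem_toFinset.mp hy)) (by simp; omega)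
  have hP := fun j => (hY j (Finset.mem_univ j)).1
  choose l hlc hln hlY using hP
  have hlZ : ∀ j, ∀ t, t ≤ 4 * k + 1 → x t ∉ l j := by
    intro j t ht hm
    have h1 : x t ∈ Y j := by rw [← hlY j]; exact List.mem_toFinset.mpr hm
    exact Finset.disjoint_left.mp (hY j (Finset.mem_univ j)).2.1 h1 (hmem t ht)
  let pos : (Fin (k + 1) ⊕ Fin k) ⊕ (Fin (k + 1) ⊕ Fin k) → ℕ :=
    Sum.elim (Sum.elim (fun j => 2 * j) (fun j => 2 * j + 1))
      (Sum.elim (fun j => 4 * k + 1 - 2 * j) (fun j => 4 * k - 2 * j))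
  have hpos : ∀ i, pos i ≤ 4 * k + 1 := by
    rintro ((j | j) | (j | j)) <;> simp only [pos, Sum.elim_inl, Sum.elim_inr] <;> omega
  have hposinj : Function.Injective pos := by
    rintro ((i | i) | (i | i)) ((j | j) | (j | j)) hij <;>
      simp only [pos, Sum.elim_inl, Sum.elim_inr] at hij <;>
      first
        | (exfalso; omega)
        | (have hij' : i = j := Fin.ext (by omega)
           rw [hij'])
  have hspine : Sum.elim
      (Sum.elim (fun j : Fin (k + 1) => x (2 * j)) (fun j : Fin k => x (2 * j + 1)))
      (Sum.elim (fun j : Fin (k + 1) => x (4 * k + 1 - 2 * j))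
        (fun j : Fin k => x (4 * k - 2 * j))) = x ∘ pos := by
    funext i
    rcases i with ((j | j) | (j | j)) <;> rfl
  have hQ : ∀ j : Fin k, ∀ y, y ∈ x (2 * j + 1) :: (l j ++ [x (4 * k - 2 * j)]) ↔
      y = x (2 * j + 1) ∨ y ∈ l j ∨ y = x (4 * k - 2 * j) := by
    intro j y; simp
  let L : Ladder D :=
    { k := k
      ev := fun j => x (2 * j)
      od := fun j => x (2 * j + 1)
      evS := fun j => x (4 * k + 1 - 2 * j)
      odS := fun j => x (4 * k - 2 * j)
      spine_injective := by
        rw [hspine]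
        intro i j hij
        exact hposinj (hinj' _ _ (hpos i) (hpos j) hij)
      adj_ev_od := fun j => hfwd (2 * j) (by omega) (by omega)
      adj_odS_evS := fun j => by
        have := hfwd (4 * k - 2 * j) (by omega) (by omega)
        rwa [show 4 * k - 2 * (j : ℕ) + 1 = 4 * k + 1 - 2 * j by omega] at this
      adj_succ_od := fun j => hbwd (2 * j + 1) (by omega) (by omega)
      adj_odS_succ := fun j => by
        have := hbwd (4 * k - 2 * j - 1) (by omega) (by omega)
        rwa [show 4 * k - 2 * (j : ℕ) - 1 + 1 = 4 * k - 2 * j by omega,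
          show 4 * k - 2 * (j : ℕ) - 1 = 4 * k + 1 - 2 * (j.succ : ℕ) by
            rw [Fin.val_succ]; omega] at this
      adj_last := by
        have := hfwd (2 * k) (by omega) (by omega)
        rwa [show 2 * k + 1 = 4 * k + 1 - 2 * k by omega] at this
      Q := fun j => x (2 * j + 1) :: (l j ++ [x (4 * k - 2 * j)])
      isPath_Q := fun j => isPath_of_isChain (hlc j) (hln j) (hlZ j _ (by omega))
        (hlZ j _ (by omega)) (fun he => by
          have := hinj' _ _ (by omega) (by omega) he
          omega)
      Q_disjoint := by
        intro i j hij y hyi hyj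
        rw [hQ] at hyi hyj
        have hne : (i : ℕ) ≠ j := fun e => hij (Fin.ext e)
        rcases hyi with rfl | hyi | rfl
        · rcases hyj with he | hyj | he
          · have := hinj' _ _ (by omega) (by omega) he; omega
          · exact hlZ j _ (by omega) hyj
          · have := hinj' _ _ (by omega) (by omega) he; omega
        · rcases hyj with rfl | hyj | rfl
          · exact hlZ i _ (by omega) hyi
          · have := hYd i (Finset.mem_univ i) j (Finset.mem_univ j) hij
            rw [← hlY i, ← hlY j] at this
            exact Finset.disjoint_left.mp this (List.mem_toFinset.mpr hyi)
              (List.mem_toFinset.mpr hyj)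
          · exact hlZ i _ (by omega) hyi
        · rcases hyj with he | hyj | he
          · have := hinj' _ _ (by omega) (by omega) he; omega
          · exact hlZ j _ (by omega) hyj
          · have := hinj' _ _ (by omega) (by omega) he; omega
      Q_spine := by
        intro j y hy hr
        rw [hspine] at hr
        obtain ⟨i, rfl⟩ := hr
        rcases (hQ j _).mp hy with h' | h' | h'
        · exact Or.inl h'
        · exact absurd h' (hlZ j _ (hpos i))
        · exact Or.inr h' }
  have hxmem : ∀ t, t ≤ 4 * k + 1 → x t ∈ ({a, b} : Set V) ∪
      ((Z ∪ Finset.univ.biUnion Y : Finset V) : Set V) := by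
    intro t ht
    rcases Nat.eq_zero_or_pos t with rfl | h0
    · left; left; exact hx0
    · rcases eq_or_lt_of_le ht with rfl | h1
      · left; right; exact hxL
      · right; exact Finset.mem_union_left _ (hmemZ t h0 h1)
  refine ⟨Z ∪ Finset.univ.biUnion Y, ⟨L, rfl, ⟨hx0, hxL⟩, ?_⟩, ?_, ?_⟩
  · rintro y (hy | ⟨j, hy⟩)
    · change y ∈ Set.range (Sum.elim
        (Sum.elim (fun j : Fin (k + 1) => x (2 * j)) (fun j : Fin k => x (2 * j + 1)))
        (Sum.elim (fun j : Fin (k + 1) => x (4 * k + 1 - 2 * j))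
          (fun j : Fin k => x (4 * k - 2 * j)))) at hy
      rw [hspine] at hy
      obtain ⟨i, rfl⟩ := hy
      exact hxmem _ (hpos i)
    · rcases (hQ j y).mp hy with rfl | hy | rfl
      · exact hxmem _ (by omega)
      · right
        refine Finset.mem_union_right _ (Finset.mem_biUnion.mpr ⟨j, Finset.mem_univ j, ?_⟩)
        rw [← hlY j]
        exact List.mem_toFinset.mpr hy
      · exact hxmem _ (by omega)
  · rw [Finset.disjoint_union_left, Finset.disjoint_biUnion_left]
    refine ⟨?_, fun j hj => (Finset.disjoint_union_right.mp (hY j hj).2.1).1⟩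
    rw [Finset.disjoint_left]
    intro y hy
    obtain ⟨t, ht, rfl⟩ := Finset.mem_image.mp hy
    rw [Finset.mem_Ioo] at ht
    exact hxX t ht.1 ht.2
  · have h1 := Finset.card_union_le Z (Finset.univ.biUnion Y)
    have h2 : (Finset.univ.biUnion Y).card ≤ k * ℓ := by
      refine Finset.card_biUnion_le.trans ((Finset.sum_le_sum fun j hj => (hY j hj).2.2).trans ?_)
      simp
    omega

namespace Ladder

variable {V : Type u} {D : Digraph V} (L : Ladder D)

/-- The list of all rung paths of a ladder. -/
def rungs : List (List V) := (List.finRange L.k).map L.rung ++ [L.lastRung]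

theorem length_rungs : L.rungs.length = L.k + 1 := by simp [rungs]

theorem ev_ne_evS (i j) : L.ev i ≠ L.evS j := fun h => by
  simpa using L.spine_injective (a₁ := .inl (.inl i)) (a₂ := .inr (.inl j)) h

theorem ev_inj {i j} (h : L.ev i = L.ev j) : i = j := by
  simpa using L.spine_injective (a₁ := .inl (.inl i)) (a₂ := .inl (.inl j)) h

theorem evS_inj {i j} (h : L.evS i = L.evS j) : i = j := by
  simpa using L.spine_injective (a₁ := .inr (.inl i)) (a₂ := .inr (.inl j)) h

theorem ev_notMem_Q (i j) : L.ev i ∉ L.Q j := fun h => by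
  rcases L.Q_spine j _ h ⟨.inl (.inl i), rfl⟩ with h' | h'
  · simpa using L.spine_injective (a₁ := .inl (.inl i)) (a₂ := .inl (.inr j)) h'
  · simpa using L.spine_injective (a₁ := .inl (.inl i)) (a₂ := .inr (.inr j)) h'

theorem evS_notMem_Q (i j) : L.evS i ∉ L.Q j := fun h => by
  rcases L.Q_spine j _ h ⟨.inr (.inl i), rfl⟩ with h' | h'
  · simpa using L.spine_injective (a₁ := .inr (.inl i)) (a₂ := .inl (.inr j)) h'
  · simpa using L.spine_injective (a₁ := .inr (.inl i)) (a₂ := .inr (.inr j)) h'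

theorem mem_rung {j x} : x ∈ L.rung j ↔ x = L.ev j.castSucc ∨ x ∈ L.Q j ∨ x = L.evS j.castSucc := by
  simp [rung]

theorem mem_lastRung {x} : x ∈ L.lastRung ↔
    x = L.ev (Fin.last L.k) ∨ x = L.evS (Fin.last L.k) := by
  simp [lastRung]

theorem isPath_rung (j) : IsPath D (L.ev j.castSucc) (L.evS j.castSucc) (L.rung j) := by
  have hQ := L.isPath_Q j
  refine isPath_of_isChain ?_ hQ.nodup (L.ev_notMem_Q _ _) (L.evS_notMem_Q _ _) (L.ev_ne_evS _ _)
  have h1 : (L.Q j ++ [L.evS j.castSucc]).IsChain D.Adj := by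
    rw [List.isChain_append]
    refine ⟨hQ.chain, by simp, ?_⟩
    intro x hx y hy
    rw [hQ.last] at hx
    simp only [Option.mem_some_iff, List.head?_cons] at hx hy
    subst hx hy
    exact L.adj_odS_evS j
  rw [List.isChain_cons]
  refine ⟨?_, h1⟩
  intro y hy
  rw [List.head?_append, hQ.head] at hy
  simp only [Option.some_or, Option.mem_some_iff] at hy
  subst hy
  exact L.adj_ev_od j

theorem isPath_lastRung :
    IsPath D (L.ev (Fin.last L.k)) (L.evS (Fin.last L.k)) L.lastRung where
  chain := by simpa [lastRung] using L.adj_last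
  nodup := by simpa [lastRung] using L.ev_ne_evS _ _
  head := rfl
  last := rfl

theorem isPath_of_mem_rungs {r : List V} (hr : r ∈ L.rungs) : ∃ a b, IsPath D a b r := by
  simp only [rungs, List.mem_append, List.mem_map, List.mem_finRange, true_and,
    List.mem_singleton] at hr
  rcases hr with ⟨j, rfl⟩ | rfl
  · exact ⟨_, _, L.isPath_rung j⟩
  · exact ⟨_, _, L.isPath_lastRung⟩

theorem nodup_flatten_rungs : L.rungs.flatten.Nodup := by
  rw [List.nodup_flatten]
  refine ⟨fun r hr => ?_, ?_⟩
  · obtain ⟨a, b, h⟩ := L.isPath_of_mem_rungs hr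
    exact h.nodup
  · rw [rungs, List.pairwise_append]
    refine ⟨?_, by simp, ?_⟩
    · rw [List.pairwise_map]
      refine (List.nodup_finRange L.k).imp ?_
      intro i j hij x hx hy
      rw [mem_rung] at hx hy
      have hne : i.castSucc ≠ j.castSucc := fun e => hij (Fin.castSucc_injective _ e)
      rcases hx with rfl | hx | rfl
      · rcases hy with hy | hy | hy
        · exact hne (L.ev_inj hy)
        · exact L.ev_notMem_Q _ _ hy
        · exact L.ev_ne_evS _ _ hy
      · rcases hy with rfl | hy | rfl
        · exact L.ev_notMem_Q _ _ hx
        · exact L.Q_disjoint i j hij hx hy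
        · exact L.evS_notMem_Q _ _ hx
      · rcases hy with hy | hy | hy
        · exact L.ev_ne_evS _ _ hy.symm
        · exact L.evS_notMem_Q _ _ hy
        · exact hne (L.evS_inj hy)
    · intro r hr r' hr'
      simp only [List.mem_map, List.mem_finRange, true_and, List.mem_singleton] at hr hr'
      obtain ⟨i, rfl⟩ := hr
      subst hr'
      intro x hx hy
      rw [mem_rung] at hx
      rw [mem_lastRung] at hy
      have hne : i.castSucc ≠ Fin.last L.k := (Fin.castSucc_lt_last i).ne
      rcases hx with rfl | hx | rfl
      · rcases hy with hy | hy
        · exact hne (L.ev_inj hy)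
        · exact L.ev_ne_evS _ _ hy
      · rcases hy with rfl | rfl
        · exact L.ev_notMem_Q _ _ hx
        · exact L.evS_notMem_Q _ _ hx
      · rcases hy with hy | hy
        · exact L.ev_ne_evS _ _ hy.symm
        · exact hne (L.evS_inj hy)

theorem mem_flatten_rungs {x : V} : x ∈ L.rungs.flatten ↔ x ∈ L.verts := by
  have hod : ∀ j, L.od j ∈ L.Q j := fun j => List.mem_of_mem_head? (L.isPath_Q j).head
  have hodS : ∀ j, L.odS j ∈ L.Q j := fun j => List.mem_of_getLast? (L.isPath_Q j).last
  have h1 : x ∈ L.rungs.flatten ↔ (∃ j, x ∈ L.rung j) ∨ x ∈ L.lastRung := by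
    simp only [List.mem_flatten, rungs, List.mem_append, List.mem_map, List.mem_finRange,
      true_and, List.mem_singleton]
    constructor
    · rintro ⟨r, ⟨j, rfl⟩ | rfl, hx⟩
      exacts [.inl ⟨j, hx⟩, .inr hx]
    · rintro (⟨j, hx⟩ | hx)
      exacts [⟨_, .inl ⟨j, rfl⟩, hx⟩, ⟨_, .inr rfl, hx⟩]
  rw [h1]
  constructor
  · rintro (⟨j, hx⟩ | hx)
    · rcases L.mem_rung.mp hx with rfl | hx | rfl
      · exact .inl ⟨.inl (.inl _), rfl⟩
      · exact .inr ⟨j, hx⟩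
      · exact .inl ⟨.inr (.inl _), rfl⟩
    · rcases L.mem_lastRung.mp hx with rfl | rfl
      · exact .inl ⟨.inl (.inl _), rfl⟩
      · exact .inl ⟨.inr (.inl _), rfl⟩
  · rintro (⟨((j | j) | (j | j)), rfl⟩ | ⟨j, hx⟩)
    · rcases Fin.eq_castSucc_or_eq_last j with ⟨i, rfl⟩ | rfl
      · exact .inl ⟨i, L.mem_rung.mpr (.inl rfl)⟩
      · exact .inr (L.mem_lastRung.mpr (.inl rfl))
    · exact .inl ⟨j, L.mem_rung.mpr (.inr (.inl (hod j)))⟩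
    · rcases Fin.eq_castSucc_or_eq_last j with ⟨i, rfl⟩ | rfl
      · exact .inl ⟨i, L.mem_rung.mpr (.inr (.inr rfl))⟩
      · exact .inr (L.mem_lastRung.mpr (.inr rfl))
    · exact .inl ⟨j, L.mem_rung.mpr (.inr (.inl (hodS j)))⟩
    · exact .inl ⟨j, L.mem_rung.mpr (.inr (.inl hx))⟩

theorem embeddedInPath_of_rungs {W : Type v} {H : Digraph W} {S : Subdivision H D} {e : Arc H}
    (h : ∀ r ∈ L.rungs, r <:+: S.path e) : L.EmbeddedInPath S e :=
  ⟨fun j => h _ (by simp [rungs]), h _ (by simp [rungs])⟩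

end Ladder

/-! ### Joining paths -/

theorem IsPath.join {V : Type u} {D : Digraph V} {a b c t : V} {p m q : List V}
    (hp : IsPath D a b p) (hq : IsPath D c t q) (hm : (b :: (m ++ [c])).IsChain D.Adj)
    (hnd : (p ++ (m ++ q)).Nodup) : IsPath D a t (p ++ (m ++ q)) where
  chain := by
    obtain ⟨p', rfl⟩ : ∃ p', p = p' ++ [b] := List.getLast?_eq_some_iff.mp hp.last
    obtain ⟨q', rfl⟩ : ∃ q', q = c :: q' := by
      obtain ⟨q', h⟩ := List.head?_eq_some_iff.mp hq.head
      exact ⟨q', h⟩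
    have h1 : ((b :: m) ++ [c] ++ q').IsChain D.Adj :=
      List.IsChain.append_overlap (by simpa using hm) (by simpa using hq.chain) (by simp)
    have h2 : (p' ++ [b] ++ (m ++ [c] ++ q')).IsChain D.Adj :=
      List.IsChain.append_overlap hp.chain (by simpa using h1) (by simp)
    simpa using h2
  nodup := hnd
  head := by rw [List.head?_append, hp.head]; rfl
  last := by rw [List.getLast?_append, List.getLast?_append, hq.last]; rfl

/-- Disjoint paths can be joined in a prescribed order to a single path that ends in a given vertex
`t`. -/
theorem FlexiblyLinked.exists_path_through {V : Type u} {D : Digraph V} {ℓ B : ℕ}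
    (h : FlexiblyLinked D ℓ B) (hℓ : 1 ≤ ℓ) (t : V) (segs : List (List V)) :
    ∀ (a b : V) (p : List V) (X : Finset V), IsPath D a b p →
      (∀ s ∈ segs, ∃ a b, IsPath D a b s) → (p ++ (segs.flatten ++ [t])).Nodup →
      (∀ x ∈ p ++ (segs.flatten ++ [t]), x ∈ X) → X.card + (segs.length + 1) * ℓ ≤ B →
      ∃ Y : Finset V, (∃ l : List V, IsPath D a t l ∧ p <:+: l ∧ (∀ s ∈ segs, s <:+: l) ∧
        ∀ x ∈ l, x ∈ p ∨ x ∈ segs.flatten ∨ x = t ∨ x ∈ Y) ∧ Disjoint Y X ∧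
        Y.card ≤ (segs.length + 1) * ℓ := by
  classical
  induction segs with
  | nil =>
    intro a b p X hp _ hnd hX hB
    obtain ⟨m, h1, h2, h3, h4⟩ := h.exists_chain hℓ b t X (by simpa using hB)
    have ht : IsPath D t t [t] := ⟨by simp, by simp, rfl, rfl⟩
    refine ⟨m.toFinset, ⟨p ++ (m ++ [t]), hp.join ht h1 ?_, ⟨[], m ++ [t], by simp⟩, by simp, ?_⟩,
      ?_, ?_⟩
    · simp only [List.flatten_nil, List.nil_append] at hnd hX
      rw [List.nodup_append'] at hnd ⊢
      refine ⟨hnd.1, ?_, ?_⟩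
      · rw [List.nodup_append']
        refine ⟨h2, by simp, fun x hx hx' => h3 x hx (hX x ?_)⟩
        exact List.mem_append_right _ hx'
      · intro x hx hx'
        rcases List.mem_append.mp hx' with hx' | hx'
        · exact h3 x hx' (hX x (List.mem_append_left _ hx))
        · exact hnd.2.2 hx hx'
    · intro x hx
      simp only [List.mem_append, List.mem_singleton] at hx
      rcases hx with hx | hx | hx
      · exact .inl hx
      · exact .inr (.inr (.inr (List.mem_toFinset.mpr hx)))
      · exact .inr (.inr (.inl hx))
    · rw [Finset.disjoint_left]
      exact fun x hx => h3 x (List.mem_toFinset.mp hx)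
    · simpa using (List.toFinset_card_le m).trans h4
  | cons s segs ih =>
    intro a b p X hp hs hnd hX hB
    obtain ⟨c, e, hse⟩ := hs s (by simp)
    simp only [List.length_cons, add_mul, one_mul] at hB ⊢
    rw [List.flatten_cons, List.append_assoc] at hnd hX
    rw [List.nodup_append'] at hnd
    obtain ⟨Y, ⟨l, hl1, hl2, hl3, hl4⟩, hYd, hYc⟩ := ih c e s X hse
      (fun r hr => hs r (List.mem_cons_of_mem _ hr)) hnd.2.1
      (fun x hx => hX x (List.mem_append_right _ hx)) (by simp only [add_mul, one_mul]; omega)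
    simp only [add_mul, one_mul] at hYc
    obtain ⟨m, h1, h2, h3, h4⟩ := h.exists_chain hℓ b c (X ∪ Y) (by
      have := Finset.card_union_le X Y
      omega)
    have hmX : ∀ x ∈ m, x ∉ X := fun x hx hx' => h3 x hx (Finset.mem_union_left _ hx')
    have hmY : ∀ x ∈ m, x ∉ Y := fun x hx hx' => h3 x hx (Finset.mem_union_right _ hx')
    have hl5 : ∀ x ∈ l, x ∈ s ++ (segs.flatten ++ [t]) ∨ x ∈ Y := by
      intro x hx
      simp only [List.mem_append, List.mem_singleton]
      rcases hl4 x hx with h' | h' | h' | h' <;> simp [h']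
    refine ⟨Y ∪ m.toFinset, ⟨p ++ (m ++ l), hp.join hl1 h1 ?_, ⟨[], m ++ l, by simp⟩, ?_, ?_⟩,
      ?_, ?_⟩
    · rw [List.nodup_append']
      refine ⟨hnd.1, ?_, ?_⟩
      · rw [List.nodup_append']
        refine ⟨h2, hl1.nodup, fun x hx hx' => ?_⟩
        rcases hl5 x hx' with h' | h'
        · exact hmX x hx (hX x (List.mem_append_right _ h'))
        · exact hmY x hx h'
      · intro x hx hx'
        have hxX : x ∈ X := hX x (List.mem_append_left _ hx)
        rcases List.mem_append.mp hx' with hx' | hx'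
        · exact hmX x hx' hxX
        · rcases hl5 x hx' with h' | h'
          · exact hnd.2.2 hx h'
          · exact Finset.disjoint_left.mp hYd h' hxX
    · have hll : l <:+: p ++ (m ++ l) := ⟨p ++ m, [], by simp⟩
      intro r hr
      rcases List.mem_cons.mp hr with rfl | hr
      · exact hl2.trans hll
      · exact (hl3 r hr).trans hll
    · intro x hx
      simp only [List.mem_append, List.flatten_cons, Finset.mem_union, List.mem_toFinset] at hx ⊢
      rcases hx with hx | hx | hx
      · exact .inl hx
      · simp [hx]
      · rcases hl4 x hx with h' | h' | h' | h' <;> simp [h']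
    · rw [Finset.disjoint_union_left]
      refine ⟨hYd, ?_⟩
      rw [Finset.disjoint_left]
      exact fun x hx => hmX x (List.mem_toFinset.mp hx)
    · have h5 := Finset.card_union_le Y m.toFinset
      have h6 := List.toFinset_card_le m
      omega

/-! ### Covering pairs -/

/-- Averaging: outside a small set `U` there is a pair `(a, b)` that covers at least the proportion
`γ² / 2` of the total weight of all pairs of distinct vertices. -/
theorem exists_pair_covering_weight {V : Type u} [Fintype V] [DecidableEq V] {D : Digraph V}
    {γ : ℝ} (hγ : 0 < γ)
    (hdeg : ∀ b x, γ * Nat.card V ≤ ({y | Step D b x y}.ncard : ℝ)) (U : Finset V)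
    (hU : (U.card : ℝ) + 3 ≤ γ * Nat.card V / 4) (s : Finset (V × V))
    (hs : ∀ q ∈ s, q.1 ≠ q.2) (w : V × V → ℝ) (hw : ∀ q ∈ s, 0 ≤ w q) (hpos : 0 < ∑ q ∈ s, w q)
    [∀ p q, Decidable (Covers D p q)] :
    ∃ a b, a ∉ U ∧ b ∉ U ∧ a ≠ b ∧
      γ ^ 2 / 2 * ∑ q ∈ s, w q ≤ ∑ q ∈ s, if Covers D (a, b) q then w q else 0 := by
  set n : ℝ := ((Nat.card V : ℕ) : ℝ) with hn
  set C : Finset (V × V) := Finset.univ.filter (fun p => p.1 ∉ U ∧ p.2 ∉ U ∧ p.1 ≠ p.2) with hC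
  by_contra! hcon
  have hγn : 0 < γ * n := by
    have : (0 : ℝ) ≤ U.card := Nat.cast_nonneg _
    linarith
  have hcard : (C.card : ℝ) ≤ n ^ 2 := by
    have : C.card ≤ Fintype.card V * Fintype.card V := by
      rw [← Fintype.card_prod]; exact Finset.card_le_univ _
    rw [hn, Nat.card_eq_fintype_card, sq]
    exact_mod_cast this
  have hcount : ∀ q ∈ s, 9 / 16 * (γ ^ 2 * n ^ 2) ≤
      ((C.filter (fun p => Covers D p q)).card : ℝ) := by
    intro q hq
    obtain ⟨x, y⟩ := q
    have hxy : x ≠ y := hs _ hq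
    have hnb : ∀ b z, ∃ A : Finset V, (∀ a ∈ A, Step D b z a ∧ a ∉ U ∧ a ≠ x ∧ a ≠ y) ∧
        3 / 4 * (γ * n) + 1 ≤ (A.card : ℝ) := by
      intro b z
      have hfin : {a | Step D b z a}.Finite := Set.toFinite _
      refine ⟨hfin.toFinset \ (U ∪ {x, y}), ?_, ?_⟩
      · intro a ha
        simp only [Finset.mem_sdiff, Set.Finite.mem_toFinset, Set.mem_ofPred_eq, Finset.mem_union,
          Finset.mem_insert, Finset.mem_singleton, not_or] at ha
        exact ⟨ha.1, ha.2.1, ha.2.2.1, ha.2.2.2⟩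
      · have h1 := Finset.le_card_sdiff (U ∪ {x, y}) hfin.toFinset
        have h2 : (U ∪ {x, y}).card ≤ U.card + 2 :=
          (Finset.card_union_le _ _).trans (Nat.add_le_add_left Finset.card_le_two _)
        have h3 := hdeg b z
        rw [Set.ncard_eq_toFinset_card _ hfin] at h3
        have h4 : hfin.toFinset.card ≤ (hfin.toFinset \ (U ∪ {x, y})).card + (U.card + 2) := by
          omega
        have h5 : (hfin.toFinset.card : ℝ) ≤
            (hfin.toFinset \ (U ∪ {x, y})).card + (U.card + 2) := by exact_mod_cast h4
        linarith
    obtain ⟨A, hA, hAc⟩ := hnb false x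
    obtain ⟨E, hE, hEc⟩ := hnb true y
    have hsub : A ×ˢ E ⊆ C.filter (fun p => Covers D p (x, y)) ∪ A.image (fun a => (a, a)) := by
      rintro ⟨a, b⟩ hab
      obtain ⟨ha, hb⟩ := Finset.mem_product.mp hab
      obtain ⟨ha1, ha2, ha3, ha4⟩ := hA a ha
      obtain ⟨hb1, hb2, hb3, hb4⟩ := hE b hb
      by_cases he : a = b
      · subst he
        exact Finset.mem_union_right _ (Finset.mem_image_of_mem _ ha)
      · refine Finset.mem_union_left _ (Finset.mem_filter.mpr ⟨?_, ?_, ha1, hb1⟩)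
        · exact Finset.mem_filter.mpr ⟨Finset.mem_univ _, ha2, hb2, he⟩
        · simp [he, ha3, ha4, hb3, hb4, hxy]
    have h1 : A.card * E.card ≤ (C.filter (fun p => Covers D p (x, y))).card + A.card := by
      rw [← Finset.card_product]
      exact (Finset.card_le_card hsub).trans ((Finset.card_union_le _ _).trans
        (Nat.add_le_add_left Finset.card_image_le _))
    have h2 : (A.card : ℝ) * E.card ≤
        ((C.filter (fun p => Covers D p (x, y))).card : ℝ) + A.card := by exact_mod_cast h1
    nlinarith [mul_le_mul hAc (show 3 / 4 * (γ * n) ≤ (E.card : ℝ) - 1 by linarith)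
      (by positivity) (by positivity)]
  have hsum : ∑ p ∈ C, ∑ q ∈ s, (if Covers D p q then w q else 0) =
      ∑ q ∈ s, ((C.filter (fun p => Covers D p q)).card : ℝ) * w q := by
    rw [Finset.sum_comm]
    refine Finset.sum_congr rfl fun q _ => ?_
    rw [← Finset.sum_filter, Finset.sum_const, nsmul_eq_mul]
  have hlow : 9 / 16 * (γ ^ 2 * n ^ 2) * ∑ q ∈ s, w q ≤
      ∑ p ∈ C, ∑ q ∈ s, (if Covers D p q then w q else 0) := by
    rw [hsum, Finset.mul_sum]
    exact Finset.sum_le_sum fun q hq => mul_le_mul_of_nonneg_right (hcount q hq) (hw q hq)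
  have hup : ∑ p ∈ C, ∑ q ∈ s, (if Covers D p q then w q else 0) ≤
      C.card * (γ ^ 2 / 2 * ∑ q ∈ s, w q) := by
    rw [← nsmul_eq_mul]
    refine Finset.sum_le_card_nsmul _ _ _ fun p hp => ?_
    obtain ⟨-, h1, h2, h3⟩ := Finset.mem_filter.mp hp
    exact (hcon p.1 p.2 h1 h2 h3).le
  have h1 : (C.card : ℝ) * (γ ^ 2 / 2 * ∑ q ∈ s, w q) ≤ n ^ 2 * (γ ^ 2 / 2 * ∑ q ∈ s, w q) :=
    mul_le_mul_of_nonneg_right hcard (by positivity)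
  have h2 : 0 < γ ^ 2 * n ^ 2 * ∑ q ∈ s, w q := by
    rw [← mul_pow]; positivity
  nlinarith

/-- Iterating the averaging step with the weights `2⁻ᶜ`, where `c` is the number of chosen pairs
that cover a given pair: each new pair lowers the total weight by the factor `1 - γ² / 4`. -/
theorem exists_disjointPairs_weight_le {V : Type u} [Fintype V] [DecidableEq V] {D : Digraph V}
    {γ : ℝ} (hγ : 0 < γ) (hγ1 : γ ≤ 1)
    (hdeg : ∀ b x, γ * Nat.card V ≤ ({y | Step D b x y}.ncard : ℝ)) (X : Finset V)
    [∀ p q, Decidable (Covers D p q)] (N : ℕ)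
    (hN : (X.card : ℝ) + 2 * N + 3 ≤ γ * Nat.card V / 4) :
    ∃ K : Finset (V × V), K.card = N ∧ DisjointPairs (K : Set (V × V)) ∧
      (∀ p ∈ K, p.1 ∉ X ∧ p.2 ∉ X) ∧
      ∑ q ∈ Finset.univ.offDiag, (1 / 2 : ℝ) ^ (K.filter (fun p => Covers D p q)).card ≤
        (Nat.card V : ℝ) ^ 2 * (1 - γ ^ 2 / 4) ^ N := by
  have hγsq : γ ^ 2 ≤ 1 := by nlinarith
  induction N with
  | zero =>
    refine ⟨∅, rfl, ⟨by simp, by simp⟩, by simp, ?_⟩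
    simp only [Finset.filter_empty, Finset.card_empty, pow_zero, Finset.sum_const, nsmul_eq_mul,
      mul_one]
    rw [Nat.card_eq_fintype_card, sq]
    have : (Finset.univ : Finset V).offDiag.card ≤ Fintype.card V * Fintype.card V := by
      rw [← Fintype.card_prod]; exact Finset.card_le_univ _
    exact_mod_cast this
  | succ N ih =>
    push_cast at hN
    obtain ⟨K, hKc, hKd, hKX, hKw⟩ := ih (by linarith)
    set w : V × V → ℝ := fun q => (1 / 2 : ℝ) ^ (K.filter (fun p => Covers D p q)).card with hw
    set U : Finset V := X ∪ (K.image Prod.fst ∪ K.image Prod.snd) with hUdef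
    have hUc : U.card ≤ X.card + 2 * N := by
      have h1 := Finset.card_union_le X (K.image Prod.fst ∪ K.image Prod.snd)
      have h2 := Finset.card_union_le (K.image Prod.fst) (K.image Prod.snd)
      have h3 : (K.image Prod.fst).card ≤ K.card := Finset.card_image_le
      have h4 : (K.image Prod.snd).card ≤ K.card := Finset.card_image_le
      rw [hUdef]; omega
    have hUc' : (U.card : ℝ) ≤ X.card + 2 * N := by exact_mod_cast hUc
    have hwpos : ∀ q, 0 < w q := fun q => by positivity
    have hne : (Finset.univ : Finset V).offDiag.Nonempty := by
      have h0 : (0 : ℝ) ≤ X.card := Nat.cast_nonneg _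
      have h0' : (0 : ℝ) ≤ N := Nat.cast_nonneg _
      have h1 : (0 : ℝ) ≤ (Nat.card V : ℝ) := Nat.cast_nonneg _
      have h2 : (1 : ℝ) < Nat.card V := by nlinarith
      have h3 : 1 < Fintype.card V := by
        rw [← Nat.card_eq_fintype_card]; exact_mod_cast h2
      obtain ⟨x, y, hxy⟩ := Fintype.one_lt_card_iff.mp h3
      exact ⟨(x, y), Finset.mem_offDiag.mpr ⟨Finset.mem_univ x, Finset.mem_univ y, hxy⟩⟩
    obtain ⟨a, b, haU, hbU, hab, hcov⟩ := exists_pair_covering_weight hγ hdeg U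
      (by linarith) Finset.univ.offDiag (fun q hq => (Finset.mem_offDiag.mp hq).2.2) w
      (fun q _ => (hwpos q).le) (Finset.sum_pos (fun q _ => hwpos q) hne)
    have hK1 : ∀ p ∈ K, p.1 ∈ U ∧ p.2 ∈ U := fun p hp =>
      ⟨Finset.mem_union_right _ (Finset.mem_union_left _ (Finset.mem_image_of_mem _ hp)),
        Finset.mem_union_right _ (Finset.mem_union_right _ (Finset.mem_image_of_mem _ hp))⟩
    have hnew : (a, b) ∉ K := fun h => haU (hK1 _ h).1
    have hdisj : ∀ p ∈ K, Disjoint ({a, b} : Set V) {p.1, p.2} := by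
      intro p hp
      have := hK1 p hp
      rw [Set.disjoint_left]
      rintro x (rfl | rfl) (h | h)
      · exact haU (h ▸ this.1)
      · exact haU (h ▸ this.2)
      · exact hbU (h ▸ this.1)
      · exact hbU (h ▸ this.2)
    refine ⟨insert (a, b) K, by rw [Finset.card_insert_of_notMem hnew, hKc], ⟨?_, ?_⟩, ?_, ?_⟩
    · intro p hp
      rcases Finset.mem_insert.mp hp with rfl | hp
      · exact hab
      · exact hKd.1 p hp
    · intro p hp q hq hpq
      rw [Finset.mem_coe, Finset.mem_insert] at hp hq
      rcases hp with rfl | hp <;> rcases hq with rfl | hq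
      · exact absurd rfl hpq
      · exact hdisj q hq
      · exact (hdisj p hp).symm
      · exact hKd.2 p hp q hq hpq
    · intro p hp
      rcases Finset.mem_insert.mp hp with rfl | hp
      · exact ⟨fun h => haU (Finset.mem_union_left _ h), fun h => hbU (Finset.mem_union_left _ h)⟩
      · exact hKX p hp
    · have hstep : ∀ q, (1 / 2 : ℝ) ^ ((insert (a, b) K).filter (fun p => Covers D p q)).card =
          w q - 1 / 2 * (if Covers D (a, b) q then w q else 0) := by
        intro q
        rw [Finset.filter_insert]
        split_ifs with hc
        · rw [Finset.card_insert_of_notMem (fun h => hnew (Finset.mem_filter.mp h).1), pow_succ]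
          ring
        · simp [hw]
      rw [Finset.sum_congr rfl fun q _ => hstep q, Finset.sum_sub_distrib, ← Finset.mul_sum,
        pow_succ (1 - γ ^ 2 / 4) N, ← mul_assoc]
      have h1 : (1 - γ ^ 2 / 4) * ∑ q ∈ Finset.univ.offDiag, w q ≤
          (1 - γ ^ 2 / 4) * ((Nat.card V : ℝ) ^ 2 * (1 - γ ^ 2 / 4) ^ N) :=
        mul_le_mul_of_nonneg_left hKw (by linarith)
      linarith

/-- Logarithmically many disjoint pairs suffice to cover every pair of distinct vertices `d`
times. -/
theorem exists_disjointPairs_dCovers {V : Type u} [Fintype V] {D : Digraph V}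
    {γ : ℝ} (hγ : 0 < γ) (hγ1 : γ ≤ 1)
    (hdeg : ∀ b x, γ * Nat.card V ≤ ({y | Step D b x y}.ncard : ℝ)) (X : Finset V) (d N : ℕ)
    (hN : (X.card : ℝ) + 2 * N + 3 ≤ γ * Nat.card V / 4)
    (hlog : 2 * Real.log (Nat.card V) + d * Real.log 2 ≤ γ ^ 2 / 4 * N) :
    ∃ K : Finset (V × V), K.card = N ∧ DisjointPairs (K : Set (V × V)) ∧
      (∀ p ∈ K, p.1 ∉ X ∧ p.2 ∉ X) ∧ DCovers D d (K : Set (V × V)) := by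
  classical
  obtain ⟨K, hKc, hKd, hKX, hKw⟩ := exists_disjointPairs_weight_le hγ hγ1 hdeg X N hN
  refine ⟨K, hKc, hKd, hKX, ?_⟩
  intro x y hxy
  have hn : (0 : ℝ) < Nat.card V := by
    have : Nonempty V := ⟨x⟩
    exact_mod_cast Nat.card_pos
  have hbound : (Nat.card V : ℝ) ^ 2 * (1 - γ ^ 2 / 4) ^ N ≤ (1 / 2 : ℝ) ^ d := by
    have h1 : (1 - γ ^ 2 / 4) ^ N ≤ Real.exp (-(γ ^ 2 / 4)) ^ N := by
      refine pow_le_pow_left₀ (by nlinarith) ?_ N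
      have := Real.add_one_le_exp (-(γ ^ 2 / 4))
      linarith
    have h2 : (Nat.card V : ℝ) ^ 2 = Real.exp (2 * Real.log (Nat.card V)) := by
      rw [mul_comm, Real.exp_mul, Real.exp_log hn]
      exact_mod_cast rfl
    have h3 : (1 / 2 : ℝ) ^ d = Real.exp (-(d * Real.log 2)) := by
      rw [← mul_neg, mul_comm, Real.exp_mul, Real.exp_neg, Real.exp_log two_pos,
        Real.rpow_natCast, one_div]
    calc (Nat.card V : ℝ) ^ 2 * (1 - γ ^ 2 / 4) ^ N
        ≤ (Nat.card V : ℝ) ^ 2 * Real.exp (-(γ ^ 2 / 4)) ^ N := by gcongr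
      _ = Real.exp (2 * Real.log (Nat.card V) + N * (-(γ ^ 2 / 4))) := by
          rw [h2, ← Real.exp_nat_mul, Real.exp_add]
      _ ≤ (1 / 2 : ℝ) ^ d := by
          rw [h3, Real.exp_le_exp]; linarith
  have hcount : d ≤ (K.filter (fun p => Covers D p (x, y))).card := by
    by_contra! hlt
    have h1 : (1 / 2 : ℝ) ^ (K.filter (fun p => Covers D p (x, y))).card ≤ (1 / 2 : ℝ) ^ d :=
      (Finset.single_le_sum
        (f := fun q => (1 / 2 : ℝ) ^ (K.filter (fun p => Covers D p q)).card)
        (fun q _ => by positivity)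
        (Finset.mem_offDiag.mpr ⟨Finset.mem_univ x, Finset.mem_univ y, hxy⟩)).trans
        (hKw.trans hbound)
    have h2 : (1 / 2 : ℝ) ^ d < (1 / 2 : ℝ) ^ (K.filter (fun p => Covers D p (x, y))).card :=
      pow_lt_pow_right_of_lt_one₀ (by norm_num) (by norm_num) hlt
    linarith
  obtain ⟨T, hT, hTc⟩ := Finset.exists_subset_card_eq hcount
  exact ⟨T, hTc, fun p hp => Finset.mem_filter.mp (hT hp)⟩

/-! ### Assembling a Type-I absorber -/

/-- In a flexibly linked digraph, disjoint pairs can be extended to disjoint ladders that avoid a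
given set `F`; all of their vertices lie in a set `X ⊇ F` of controlled size. -/
theorem FlexiblyLinked.exists_ladders {V : Type u} {D : Digraph V} {ℓ B : ℕ}
    (hlink : FlexiblyLinked D ℓ B) (hℓ : 1 ≤ ℓ) (K : Finset (V × V))
    (hK : DisjointPairs (K : Set (V × V))) (F : Finset V) (hKF : ∀ p ∈ K, p.1 ∉ F ∧ p.2 ∉ F)
    (hB : F.card + 2 * K.card + K.card * (4 * ℓ + 2 + ℓ * ℓ) ≤ B) :
    ∃ (L : K → Ladder D) (X : Finset V), (∀ p, (L p).k = ℓ ∧ (L p).FromTo p.1.1 p.1.2) ∧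
      (∀ p q, p ≠ q → Disjoint (L p).verts (L q).verts) ∧ F ⊆ X ∧
      (∀ p, ∀ x ∈ (L p).verts, x ∈ X ∧ x ∉ F) ∧
      X.card ≤ F.card + 2 * K.card + K.card * (4 * ℓ + 2 + ℓ * ℓ) := by
  classical
  set X₀ : Finset V := F ∪ (K.image Prod.fst ∪ K.image Prod.snd) with hX₀
  have hX₀c : X₀.card ≤ F.card + 2 * K.card := by
    have h1 := Finset.card_union_le F (K.image Prod.fst ∪ K.image Prod.snd)
    have h2 := Finset.card_union_le (K.image Prod.fst) (K.image Prod.snd)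
    have h3 : (K.image Prod.fst).card ≤ K.card := Finset.card_image_le
    have h4 : (K.image Prod.snd).card ≤ K.card := Finset.card_image_le
    rw [hX₀]; omega
  have hends : ∀ p ∈ K, p.1 ∈ X₀ ∧ p.2 ∈ X₀ := fun p hp =>
    ⟨Finset.mem_union_right _ (Finset.mem_union_left _ (Finset.mem_image_of_mem _ hp)),
      Finset.mem_union_right _ (Finset.mem_union_right _ (Finset.mem_image_of_mem _ hp))⟩
  have hsum : ∑ _i : K, (4 * ℓ + 2 + ℓ * ℓ) = K.card * (4 * ℓ + 2 + ℓ * ℓ) := by simp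
  obtain ⟨Y, hY, hYd⟩ := exists_pairwiseDisjoint_family (Finset.univ : Finset K)
    (fun p Y => (∃ L : Ladder D, L.k = ℓ ∧ L.FromTo p.1.1 p.1.2 ∧
      L.verts ⊆ {p.1.1, p.1.2} ∪ (Y : Set V)))
    (fun _ => 4 * ℓ + 2 + ℓ * ℓ) B X₀ (fun p _ X hX₀X hX =>
      hlink.exists_ladder hℓ ℓ (by omega) (hK.1 p.1 p.2) X (hX₀X (hends _ p.2).1)
        (hX₀X (hends _ p.2).2) hX)
    (by rw [hsum]; omega)
  have hP := fun p => (hY p (Finset.mem_univ p)).1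
  choose L hLk hLft hLv using hP
  refine ⟨L, X₀ ∪ Finset.univ.biUnion Y, fun p => ⟨hLk p, hLft p⟩, ?_,
    Finset.subset_union_left.trans Finset.subset_union_left, ?_, ?_⟩
  · intro p q hpq
    refine Disjoint.mono (hLv p) (hLv q) ?_
    have h1 : ∀ p : K, ∀ x ∈ ({p.1.1, p.1.2} : Set V), x ∈ X₀ := by
      rintro p x (rfl | rfl)
      exacts [(hends _ p.2).1, (hends _ p.2).2]
    have h2 : ∀ q, ∀ x ∈ Y q, x ∉ X₀ := fun q x hx =>
      Finset.disjoint_left.mp (hY q (Finset.mem_univ q)).2.1 hx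
    rw [Set.disjoint_left]
    rintro x (hx | hx) (hx' | hx')
    · exact Set.disjoint_left.mp
        (hK.2 p.1 p.2 q.1 q.2 fun e => hpq (Subtype.ext e)) hx hx'
    · exact h2 q x hx' (h1 p x hx)
    · exact h2 p x hx (h1 q x hx')
    · exact Finset.disjoint_left.mp
        (hYd p (Finset.mem_univ p) q (Finset.mem_univ q) hpq) hx hx'
  · intro p x hx
    rcases hLv p hx with (rfl | rfl) | hx
    · exact ⟨Finset.mem_union_left _ (hends _ p.2).1, (hKF _ p.2).1⟩
    · exact ⟨Finset.mem_union_left _ (hends _ p.2).2, (hKF _ p.2).2⟩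
    · exact ⟨Finset.mem_union_right _ (Finset.mem_biUnion.mpr ⟨p, Finset.mem_univ p, hx⟩),
        fun hF => Finset.disjoint_left.mp (hY p (Finset.mem_univ p)).2.1 hx
          (Finset.mem_union_left _ hF)⟩
  · have h1 := Finset.card_union_le X₀ (Finset.univ.biUnion Y)
    have h2 : (Finset.univ.biUnion Y).card ≤ K.card * (4 * ℓ + 2 + ℓ * ℓ) := by
      rw [← hsum]
      exact Finset.card_biUnion_le.trans (Finset.sum_le_sum fun p hp => (hY p hp).2.2)
    omega

/-- Disjoint ladders that avoid the branch vertices can be embedded in an `H`-subdivision with any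
prescribed assignment `g` of the ladders to the arcs of `H`: the path of an arc `e` runs through
the rungs of all ladders assigned to `e`. -/
theorem FlexiblyLinked.exists_subdivision {V : Type u} {W : Type v} [Finite W] {D : Digraph V}
    {ℓ B : ℕ} (hlink : FlexiblyLinked D ℓ B) (hℓ : 1 ≤ ℓ) {H : Digraph W} (hH : Loopless H)
    {f : W → V} (hf : Function.Injective f) {ι : Type*} [Finite ι] (L : ι → Ladder D) (k : ℕ)
    (hk : ∀ p, (L p).k = k) (hL : ∀ p q, p ≠ q → Disjoint (L p).verts (L q).verts)
    (X : Finset V) (hfX : ∀ w, f w ∈ X)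
    (hLX : ∀ p, ∀ x ∈ (L p).verts, x ∈ X ∧ x ∉ Set.range f) (g : ι → Arc H)
    (hB : X.card + (Nat.card ι * (k + 1) + Nat.card (Arc H)) * ℓ ≤ B) :
    ∃ S : Subdivision H D, S.branch = f ∧ (∀ p, (L p).EmbeddedInPath S (g p)) ∧
      ∃ X' : Finset V, X ⊆ X' ∧ S.verts ⊆ X' ∧
        X'.card ≤ X.card + (Nat.card ι * (k + 1) + Nat.card (Arc H)) * ℓ := by
  classical
  have := Fintype.ofFinite ι
  have := Fintype.ofFinite (Arc H)
  let fib : Arc H → List ι := fun e => (Finset.univ.filter (fun p => g p = e)).toList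
  have hfib : ∀ e p, p ∈ fib e ↔ g p = e := fun e p => by simp [fib]
  let segs : Arc H → List (List V) := fun e => (fib e).flatMap (fun p => (L p).rungs)
  have hsegs : ∀ e x, x ∈ (segs e).flatten ↔ ∃ p, g p = e ∧ x ∈ (L p).verts := by
    intro e x
    simp only [segs, List.mem_flatten, List.mem_flatMap]
    constructor
    · rintro ⟨r, ⟨p, hp, hr⟩, hx⟩
      exact ⟨p, (hfib e p).mp hp, (L p).mem_flatten_rungs.mp (List.mem_flatten.mpr ⟨r, hr, hx⟩)⟩
    · rintro ⟨p, hp, hx⟩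
      obtain ⟨r, hr, hx⟩ := List.mem_flatten.mp ((L p).mem_flatten_rungs.mpr hx)
      exact ⟨r, ⟨p, (hfib e p).mpr hp, hr⟩, hx⟩
  have hnodup : ∀ e, (segs e).flatten.Nodup := by
    intro e
    have h1 : (segs e).flatten = (fib e).flatMap (fun p => (L p).rungs.flatten) := by
      simp [segs, List.flatMap, List.flatten_flatten, List.map_map, Function.comp_def]
    rw [h1, List.nodup_flatMap]
    refine ⟨fun p _ => (L p).nodup_flatten_rungs, ?_⟩
    refine (Finset.nodup_toList _).imp ?_
    intro p q hpq x hx hx'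
    exact Set.disjoint_left.mp (hL p q hpq) ((L p).mem_flatten_rungs.mp hx)
      ((L q).mem_flatten_rungs.mp hx')
  have hlen : ∀ e, (segs e).length = (Finset.univ.filter (fun p => g p = e)).card * (k + 1) := by
    intro e
    simp [segs, fib, List.length_flatMap, Ladder.length_rungs, hk]
  have hcost : ∑ e, ((segs e).length + 1) * ℓ =
      (Nat.card ι * (k + 1) + Nat.card (Arc H)) * ℓ := by
    rw [← Finset.sum_mul, Finset.sum_add_distrib, Finset.sum_congr rfl fun e _ => hlen e,
      ← Finset.sum_mul, ← Finset.card_eq_sum_card_fiberwise (fun p _ => Finset.mem_univ (g p))]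
    simp [Nat.card_eq_fintype_card]
  have hne : ∀ e : Arc H, f e.1.1 ≠ f e.1.2 := by
    intro e he
    have h2 := e.2
    rw [hf he] at h2
    exact hH _ h2
  obtain ⟨Y, hY, hYd⟩ := exists_pairwiseDisjoint_family (Finset.univ : Finset (Arc H))
    (fun e Y => ∃ l : List V, IsPath D (f e.1.1) (f e.1.2) l ∧ [f e.1.1] <:+: l ∧
      (∀ s ∈ segs e, s <:+: l) ∧
      ∀ x ∈ l, x ∈ [f e.1.1] ∨ x ∈ (segs e).flatten ∨ x = f e.1.2 ∨ x ∈ Y)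
    (fun e => ((segs e).length + 1) * ℓ) B X (by
      intro e _ X' hXX' hX'
      have hp : IsPath D (f e.1.1) (f e.1.1) [f e.1.1] := ⟨by simp, by simp, rfl, rfl⟩
      refine hlink.exists_path_through hℓ (f e.1.2) (segs e) _ _ _ X' hp ?_ ?_ ?_ hX'
      · intro s hs
        obtain ⟨p, -, hs⟩ := List.mem_flatMap.mp hs
        exact (L p).isPath_of_mem_rungs hs
      · have h3 : ∀ w, f w ∉ (segs e).flatten := by
          intro w hw
          obtain ⟨p, -, hx⟩ := (hsegs e _).mp hw
          exact (hLX p _ hx).2 ⟨w, rfl⟩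
        rw [List.singleton_append, List.nodup_cons, List.nodup_append']
        refine ⟨?_, hnodup e, by simp, ?_⟩
        · rw [List.mem_append, List.mem_singleton]
          rintro (h | h)
          exacts [h3 _ h, hne e h]
        · intro x hx hx'
          rw [List.mem_singleton] at hx'
          exact h3 _ (hx' ▸ hx)
      · intro x hx
        apply hXX'
        simp only [List.mem_append, List.mem_singleton] at hx
        rcases hx with rfl | hx | rfl
        · exact hfX _
        · obtain ⟨p, -, hx⟩ := (hsegs e _).mp hx
          exact (hLX p _ hx).1
        · exact hfX _)
    (by rw [hcost]; exact hB)
  have hP := fun e => (hY e (Finset.mem_univ e)).1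
  choose l hlp _ hls hlm using hP
  have hYX : ∀ e, ∀ x ∈ Y e, x ∉ X := fun e x hx =>
    Finset.disjoint_left.mp (hY e (Finset.mem_univ e)).2.1 hx
  have hlm' : ∀ e, ∀ x ∈ l e, (x = f e.1.1 ∨ x = f e.1.2) ∨ (∃ p, g p = e ∧ x ∈ (L p).verts) ∨
      x ∈ Y e := by
    intro e x hx
    rcases hlm e x hx with h | h | h | h
    · exact .inl (.inl (List.mem_singleton.mp h))
    · exact .inr (.inl ((hsegs e x).mp h))
    · exact .inl (.inr h)
    · exact .inr (.inr h)
  let S : Subdivision H D :=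
    { branch := f
      branch_injective := hf
      path := l
      isPath := hlp
      branch_mem := by
        intro e w hw
        rcases hlm' e _ hw with (h | h) | ⟨p, -, h⟩ | h
        · exact .inl (hf h)
        · exact .inr (hf h)
        · exact absurd ⟨w, rfl⟩ (hLX p _ h).2
        · exact absurd (hfX w) (hYX e _ h)
      disjoint := by
        intro e e' hee' x hx hx'
        rcases hlm' e x hx with (rfl | rfl) | ⟨p, hp, h⟩ | h
        · exact ⟨_, rfl⟩
        · exact ⟨_, rfl⟩
        · rcases hlm' e' x hx' with (rfl | rfl) | ⟨q, hq, h'⟩ | h'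
          · exact ⟨_, rfl⟩
          · exact ⟨_, rfl⟩
          · refine absurd h' (Set.disjoint_left.mp (hL p q ?_) h)
            rintro rfl
            exact hee' (hp.symm.trans hq)
          · exact absurd (hLX p x h).1 (hYX e' x h')
        · rcases hlm' e' x hx' with (rfl | rfl) | ⟨q, hq, h'⟩ | h'
          · exact ⟨_, rfl⟩
          · exact ⟨_, rfl⟩
          · exact absurd (hLX q x h').1 (hYX e x h)
          · exact absurd h' (Finset.disjoint_left.mp
              (hYd e (Finset.mem_univ e) e' (Finset.mem_univ e') hee') h) }
  refine ⟨S, rfl, ?_, X ∪ Finset.univ.biUnion Y, Finset.subset_union_left, ?_, ?_⟩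
  · intro p
    refine (L p).embeddedInPath_of_rungs fun r hr => hls (g p) r ?_
    exact List.mem_flatMap.mpr ⟨p, (hfib _ p).mpr rfl, hr⟩
  · rintro x (⟨w, rfl⟩ | ⟨e, hx⟩)
    · exact Finset.mem_union_left _ (hfX w)
    · rcases hlm' e x hx with (rfl | rfl) | ⟨p, -, h⟩ | h
      · exact Finset.mem_union_left _ (hfX _)
      · exact Finset.mem_union_left _ (hfX _)
      · exact Finset.mem_union_left _ (hLX p x h).1
      · exact Finset.mem_union_right _ (Finset.mem_biUnion.mpr ⟨e, Finset.mem_univ e, h⟩)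
  · have h1 := Finset.card_union_le X (Finset.univ.biUnion Y)
    have h2 : (Finset.univ.biUnion Y).card ≤
        (Nat.card ι * (k + 1) + Nat.card (Arc H)) * ℓ := by
      rw [← hcost]
      exact Finset.card_biUnion_le.trans (Finset.sum_le_sum fun e he => (hY e he).2.2)
    omega

/-- The number of vertices used by the construction, for `N` pairs, walks of length `ℓ`, and a
digraph `H` with `w` vertices and `h` arcs: the vertices of `H` and of the pairs, the new vertices
of the ladders, and the new vertices that join the rungs to paths. -/
def vertexBudget (w h N ℓ : ℕ) : ℕ :=
  w + 2 * N + N * (4 * ℓ + 2 + ℓ * ℓ) + (N * (ℓ + 1) + h) * ℓ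

/-- In a flexibly linked digraph, disjoint covering pairs, at least as many as `H` has arcs, extend
to a Type-I absorber with prescribed branch vertices. -/
theorem FlexiblyLinked.exists_isTypeIAbsorber {V : Type u} {W : Type v} [Finite W]
    {D : Digraph V} {ℓ B : ℕ} (hlink : FlexiblyLinked D ℓ B) (hℓ : 1 ≤ ℓ) {H : Digraph W}
    (hH : Loopless H) [Nonempty (Arc H)] {f : W → V} (hf : Function.Injective f) {d : ℕ}
    (K : Finset (V × V)) (hK : DisjointPairs (K : Set (V × V)))
    (hKd : DCovers D d (K : Set (V × V)))
    (hKf : ∀ p ∈ K, p.1 ∉ Set.range f ∧ p.2 ∉ Set.range f) (hcard : Nat.card (Arc H) ≤ K.card)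
    (hB : vertexBudget (Nat.card W) (Nat.card (Arc H)) K.card ℓ ≤ B) :
    ∃ (Ls : Set (Ladder D)) (S : Subdivision H D),
      IsTypeIAbsorber d (K : Set (V × V)) Ls S ∧ S.branch = f ∧
      ∃ X : Finset V, absorberVerts (K : Set (V × V)) Ls {S} ⊆ X ∧
        X.card ≤ vertexBudget (Nat.card W) (Nat.card (Arc H)) K.card ℓ := by
  classical
  have := Fintype.ofFinite W
  have := Fintype.ofFinite (Arc H)
  have hF : ∀ x, x ∈ Finset.univ.image f ↔ x ∈ Set.range f := by simp
  have hFc : (Finset.univ.image f).card ≤ Nat.card W := by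
    rw [Nat.card_eq_fintype_card]; exact Finset.card_image_le
  rw [vertexBudget] at hB ⊢
  obtain ⟨L, X, hL, hLd, hFX, hLX, hXc⟩ := hlink.exists_ladders hℓ K hK (Finset.univ.image f)
    (fun p hp => by rw [hF, hF]; exact hKf p hp) (by omega)
  obtain ⟨g, hg⟩ : ∃ g : K → Arc H, Function.Surjective g := by
    obtain ⟨i⟩ := Function.Embedding.nonempty_of_card_le (α := Arc H) (β := K) (by
      rwa [Fintype.card_coe, ← Nat.card_eq_fintype_card])
    exact ⟨Function.invFun i, Function.invFun_surjective i.injective⟩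
  have hKc : Nat.card K = K.card := by simp
  obtain ⟨S, hSf, hSL, X', hXX', hSX', hXc'⟩ := hlink.exists_subdivision hℓ hH hf L ℓ
    (fun p => (hL p).1) hLd X (fun w => hFX ((hF _).mpr ⟨w, rfl⟩))
    (fun p x hx => ⟨(hLX p x hx).1, fun h => (hLX p x hx).2 ((hF x).mpr h)⟩) g
    (by rw [hKc]; omega)
  rw [hKc] at hXc'
  refine ⟨Set.range L, S, ⟨⟨hK, hKd, ?_, ?_⟩, ?_, ?_⟩, hSf, X', ?_, by omega⟩
  · rintro _ ⟨p, rfl⟩ _ ⟨q, rfl⟩ hpq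
    exact hLd p q fun e => hpq (by rw [e])
  · exact fun p hp => ⟨L ⟨p, hp⟩, ⟨_, rfl⟩, (hL ⟨p, hp⟩).2⟩
  · rintro _ ⟨p, rfl⟩
    exact ⟨g p, hSL p⟩
  · intro e
    obtain ⟨p, rfl⟩ := hg e
    exact ⟨L p, ⟨p, rfl⟩, hSL p⟩
  · have hLX' : ∀ p, ∀ x ∈ (L p).verts, x ∈ X' := fun p x hx => hXX' (hLX p x hx).1
    rintro x ((⟨p, hp, hx⟩ | hx) | hx)
    · obtain ⟨h1, h2⟩ := (hL ⟨p, hp⟩).2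
      refine hLX' ⟨p, hp⟩ x (.inl ?_)
      rcases hx with rfl | rfl
      · exact ⟨.inl (.inl 0), h1⟩
      · exact ⟨.inr (.inl 0), h2⟩
    · simp only [Set.mem_iUnion] at hx
      obtain ⟨_, ⟨p, rfl⟩, hx⟩ := hx
      exact hLX' p x hx
    · simp only [Set.mem_iUnion, Set.mem_singleton_iff] at hx
      obtain ⟨_, rfl, hx⟩ := hx
      exact hSX' hx

/-! ### Numerical estimates -/

/-- The lower bound on `n` makes the size `m = γ⁻² (d log (d γ⁻²) + log n)` a small multiple of
`ν³ n`. -/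
theorem size_le_of_lt {ν γ : ℝ} {n d : ℕ} (hν : 0 < ν) (hν1 : ν ≤ 1) (hγ : 0 < γ) (hγ1 : γ ≤ 1)
    (hd : 8 ≤ d)
    (hn : 10 ^ 5 * (d : ℝ) * (γ ^ 2)⁻¹ * (ν ^ 3)⁻¹ * Real.log (1500 * d * (γ ^ 2)⁻¹ * ν⁻¹) < n) :
    100 * (ν ^ 3)⁻¹ * ((γ ^ 2)⁻¹ * (d * Real.log (d * (γ ^ 2)⁻¹) + Real.log n)) ≤ n := by
  have hd' : (8 : ℝ) ≤ d := by exact_mod_cast hd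
  have hc : 1 ≤ ν⁻¹ := (one_le_inv₀ hν).mpr hν1
  have ha : 1 ≤ (γ ^ 2)⁻¹ := (one_le_inv₀ (by positivity)).mpr (pow_le_one₀ hγ.le hγ1)
  have hb3 : (ν ^ 3)⁻¹ = ν⁻¹ ^ 3 := by rw [inv_pow]
  rw [hb3] at hn ⊢
  set a := (γ ^ 2)⁻¹
  set c := ν⁻¹
  set T := Real.log (1500 * d * a * c) with hT
  have hb : 1 ≤ c ^ 3 := one_le_pow₀ hc
  have hda : 8 ≤ d * a := by nlinarith
  have hT1 : Real.log (d * a) ≤ T := by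
    refine Real.log_le_log (by positivity) ?_
    nlinarith [mul_le_mul hda hc (by norm_num) (by positivity)]
  have hT0 : 0 ≤ T := (Real.log_nonneg (by linarith)).trans hT1
  have hn0 : (0 : ℝ) < n := lt_of_le_of_lt (by positivity) hn
  have hab : 0 < 200 * a * c ^ 3 := by positivity
  have hlog : Real.log n ≤ n / (200 * a * c ^ 3) + 3 * T := by
    have h1 : Real.log n = Real.log (n / (200 * a * c ^ 3)) + Real.log (200 * a * c ^ 3) := by
      rw [Real.log_div hn0.ne' hab.ne']; ring
    have h2 : Real.log (n / (200 * a * c ^ 3)) ≤ n / (200 * a * c ^ 3) :=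
      (Real.log_le_sub_one_of_pos (by positivity)).trans (by linarith)
    have h3 : Real.log (200 * a * c ^ 3) ≤ 3 * T := by
      have h4 : 3 * T = Real.log ((1500 * d * a * c) ^ 3) := by
        rw [Real.log_pow]; push_cast; rfl
      rw [h4]
      refine Real.log_le_log hab ?_
      have h5 : 200 * a ≤ (1500 * d * a) ^ 3 := by
        have h6 : 1 ≤ 1500 * (d : ℝ) * a := by nlinarith
        have h7 : 200 * a ≤ 1500 * d * a := by nlinarith
        exact h7.trans (le_self_pow₀ h6 (by norm_num))
      rw [mul_pow _ c]
      exact mul_le_mul_of_nonneg_right h5 (by positivity)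
    linarith
  have e1 : 100 * c ^ 3 * a * Real.log n ≤ n / 2 + 300 * (a * c ^ 3 * T) := by
    have := mul_le_mul_of_nonneg_left hlog (show 0 ≤ 100 * c ^ 3 * a by positivity)
    have e : 100 * c ^ 3 * a * (n / (200 * a * c ^ 3) + 3 * T) =
        n / 2 + 300 * (a * c ^ 3 * T) := by
      have : a ≠ 0 := by positivity
      have : c ≠ 0 := by positivity
      field_simp
      ring
    linarith
  have e2 : 100 * c ^ 3 * a * (d * Real.log (d * a)) ≤ 100 * (d * (a * c ^ 3 * T)) := by
    have := mul_le_mul_of_nonneg_left hT1 (show 0 ≤ 100 * c ^ 3 * a * d by positivity)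
    linarith
  have hP : 0 ≤ a * c ^ 3 * T := by positivity
  have e3 : 8 * (a * c ^ 3 * T) ≤ d * (a * c ^ 3 * T) := mul_le_mul_of_nonneg_right hd' hP
  have e4 : 10 ^ 5 * (d * (a * c ^ 3 * T)) < n := by linarith
  linarith

theorem vertexBudget_le {w h N ℓ : ℕ} {m x : ℝ} (hℓ : 18 ≤ ℓ) (hw : w ≤ 2 * h) (hh : (h : ℝ) ≤ m)
    (hN : (N : ℝ) ≤ 9 * m) (hx : (ℓ : ℝ) ≤ 19 / 16 * x) :
    (vertexBudget w h N ℓ : ℝ) ≤ 40 * m * x ^ 2 := by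
  have hℓ' : (18 : ℝ) ≤ ℓ := by exact_mod_cast hℓ
  have hw' : (w : ℝ) ≤ 2 * h := by exact_mod_cast hw
  have hh0 : (0 : ℝ) ≤ h := Nat.cast_nonneg _
  have hN0 : (0 : ℝ) ≤ N := Nat.cast_nonneg _
  have h1 : (vertexBudget w h N ℓ : ℝ) ≤ (3 * N + h) * (ℓ : ℝ) ^ 2 := by
    simp only [vertexBudget]
    push_cast
    nlinarith [mul_nonneg hN0 (show (0 : ℝ) ≤ ℓ ^ 2 - 5 * ℓ - 4 by nlinarith),
      mul_nonneg hh0 (show (0 : ℝ) ≤ ℓ ^ 2 - ℓ - 2 by nlinarith)]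
  have h2 : (ℓ : ℝ) ^ 2 ≤ (19 / 16 * x) ^ 2 := pow_le_pow_left₀ (by linarith) hx 2
  calc (vertexBudget w h N ℓ : ℝ) ≤ (3 * N + h) * (ℓ : ℝ) ^ 2 := h1
    _ ≤ (28 * m) * (19 / 16 * x) ^ 2 := mul_le_mul (by linarith) h2 (by positivity) (by linarith)
    _ ≤ 40 * m * x ^ 2 := by nlinarith [mul_nonneg (hh0.trans hh) (sq_nonneg x)]

/-! ### Absorbers in robust expanders -/

theorem NoIsolatedVertices.card_le {W : Type v} [Finite W] {H : Digraph W}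
    (h : NoIsolatedVertices H) : Nat.card W ≤ 2 * Nat.card (Arc H) := by
  have hs : Function.Surjective
      (Sum.elim (fun e : Arc H => e.1.1) (fun e : Arc H => e.1.2)) := by
    intro x
    obtain ⟨y, hy | hy⟩ := h x
    · exact ⟨.inl ⟨(x, y), hy⟩, rfl⟩
    · exact ⟨.inr ⟨(y, x), hy⟩, rfl⟩
  have := Nat.card_le_card_of_surjective _ hs
  rw [Nat.card_sum] at this
  omega

theorem le_ncard_step_of_le_minSemidegree {V : Type u} [Finite V] {D : Digraph V} {c : ℝ}
    (h : c ≤ minSemidegree D) (b : Bool) (x : V) :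
    c ≤ ({y | Step D b x y}.ncard : ℝ) := by
  have h1 : minSemidegree D ≤ min (outDegree D x) (inDegree D x) :=
    ciInf_le (OrderBot.bddBelow _) x
  refine h.trans ?_
  cases b
  · exact_mod_cast h1.trans (min_le_right _ _)
  · exact_mod_cast h1.trans (min_le_left _ _)

/-- A robust expander contains Type-I absorbers with prescribed branch vertices. The constant `8` in
the number `⌈8 m⌉` of pairs is what the covering argument needs; the linkage length `⌈1 / ν⌉ + 2` is
the number of steps after which everything is reached. -/
theorem IsRobustExpander.exists_isTypeIAbsorber {V : Type u} [Fintype V] {W : Type v} [Fintype W]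
    [Nonempty W] {H : Digraph W} (hH : Loopless H) (hHiso : NoIsolatedVertices H) {D : Digraph V}
    {ν τ γ m : ℝ} {n d : ℕ} (hν : 0 < ν) (hντ : ν ≤ τ) (hτγ : τ ≤ γ / 16) (hγ1 : γ ≤ 1)
    (hd : 8 ≤ d) (hm : m = (γ ^ 2)⁻¹ * (d * Real.log (d * (γ ^ 2)⁻¹) + Real.log n))
    (hmn : 100 * (ν ^ 3)⁻¹ * m ≤ n) (hVn : Nat.card V = n) (hrob : IsRobustExpander D ν τ)
    (hdeg : γ * n ≤ minSemidegree D) (hsize : (Nat.card (Arc H) : ℝ) ≤ m) {f : W → V}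
    (hf : Function.Injective f) :
    ∃ (K : Set (V × V)) (Ls : Set (Ladder D)) (S : Subdivision H D),
      IsTypeIAbsorber d K Ls S ∧ S.branch = f ∧
      ∃ X : Finset V, absorberVerts K Ls {S} ⊆ X ∧ (X.card : ℝ) ≤ absorberBound n d ν γ := by
  classical
  have hγ : 0 < γ := by linarith
  have hd' : (8 : ℝ) ≤ d := by exact_mod_cast hd
  have ha : 1 ≤ (γ ^ 2)⁻¹ := (one_le_inv₀ (by positivity)).mpr (pow_le_one₀ hγ.le hγ1)
  have hda : 8 ≤ d * (γ ^ 2)⁻¹ := hd'.trans (le_mul_of_one_le_right (by linarith) ha)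
  have hlog2 : Real.log 2 ≤ Real.log (d * (γ ^ 2)⁻¹) :=
    Real.log_le_log two_pos (by linarith)
  have hlogda : 2 ≤ Real.log (d * (γ ^ 2)⁻¹) := by
    have h1 : Real.log 8 = 3 * Real.log 2 := by
      rw [show (8 : ℝ) = 2 ^ 3 by norm_num, Real.log_pow]; norm_num
    have h2 := Real.log_two_gt_d9
    have h3 := Real.log_le_log (by norm_num) hda
    linarith
  have hlogn : 0 ≤ Real.log n := Real.log_natCast_nonneg n
  have hm16 : 16 ≤ m := by
    rw [hm]
    have h1 := mul_le_mul hd' hlogda (by norm_num) (by linarith)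
    have h2 : 16 ≤ d * Real.log (d * (γ ^ 2)⁻¹) + Real.log n := by linarith
    exact h2.trans (le_mul_of_one_le_left (by linarith) ha)
  obtain ⟨x₀⟩ : Nonempty (Arc H) := by
    obtain ⟨w⟩ := ‹Nonempty W›
    obtain ⟨y, hy | hy⟩ := hHiso w
    exacts [⟨⟨(w, y), hy⟩⟩, ⟨⟨(y, w), hy⟩⟩]
  have : Nonempty (Arc H) := ⟨x₀⟩
  set c : ℝ := ν⁻¹ with hc
  have hνc : ν * c = 1 := mul_inv_cancel₀ hν.ne'
  have hc16 : 16 ≤ c := by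
    rw [hc, le_inv_comm₀ (by norm_num) hν]; linarith
  have hmn' : 100 * c ^ 3 * m ≤ n := by rw [hc, inv_pow]; exact hmn
  have hνn : 100 * c ^ 2 * m ≤ ν * n := by
    have h1 := mul_le_mul_of_nonneg_left hmn' hν.le
    have h2 : ν * (100 * c ^ 3 * m) = (ν * c) * (100 * c ^ 2 * m) := by ring
    rw [h2, hνc, one_mul] at h1
    exact h1
  have hdeg' : ∀ b x, γ * Nat.card V ≤ ({y | Step D b x y}.ncard : ℝ) := by
    rw [hVn]; exact le_ncard_step_of_le_minSemidegree hdeg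
  set ℓ : ℕ := ⌈1 / ν⌉₊ + 2 with hℓdef
  have hℓc : (⌈1 / ν⌉₊ : ℝ) < c + 1 := by
    have := Nat.ceil_lt_add_one (show 0 ≤ 1 / ν by positivity)
    rwa [one_div] at this ⊢
  have hℓc' : c ≤ (⌈1 / ν⌉₊ : ℝ) := by
    have := Nat.le_ceil (1 / ν)
    rwa [one_div] at this ⊢
  have hℓ18 : 18 ≤ ℓ := by
    have : (16 : ℝ) ≤ (⌈1 / ν⌉₊ : ℝ) := by linarith
    have : 16 ≤ ⌈1 / ν⌉₊ := by exact_mod_cast this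
    omega
  have hlink : FlexiblyLinked D ℓ ⌊ν * n⌋₊ := by
    refine hrob.flexiblyLinked hν hντ hτγ hdeg' _ _ ?_ ?_
    · rw [hℓdef, one_div]; push_cast; rw [one_div] at hℓc'; linarith
    · rw [hVn]; exact Nat.floor_le (by positivity)
  set N : ℕ := ⌈8 * m⌉₊ with hNdef
  have hN8 : 8 * m ≤ N := Nat.le_ceil _
  have hN9 : (N : ℝ) ≤ 9 * m := by
    have := Nat.ceil_lt_add_one (show 0 ≤ 8 * m by linarith)
    linarith
  have hW : Nat.card W ≤ 2 * Nat.card (Arc H) := hHiso.card_le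
  have hW' : (Nat.card W : ℝ) ≤ 2 * m := by
    have : (Nat.card W : ℝ) ≤ 2 * Nat.card (Arc H) := by exact_mod_cast hW
    linarith
  have hFc : ((Finset.univ.image f).card : ℝ) ≤ Nat.card W := by
    rw [Nat.card_eq_fintype_card]
    exact_mod_cast (Finset.card_image_le : (Finset.univ.image f).card ≤ Finset.univ.card)
  obtain ⟨K, hKc, hKd, hKX, hKcov⟩ := exists_disjointPairs_dCovers hγ hγ1 hdeg'
    (Finset.univ.image f) d N (by
      rw [hVn]
      have h1 : 4 * (ν * n) ≤ γ * n / 4 := by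
        have := mul_le_mul_of_nonneg_right (hντ.trans hτγ) (Nat.cast_nonneg (α := ℝ) n)
        linarith
      have h2 : 16 * 16 * m ≤ c ^ 2 * m := by
        have : 16 * 16 ≤ c ^ 2 := by
          rw [sq]; exact mul_le_mul hc16 hc16 (by norm_num) (by linarith)
        exact mul_le_mul_of_nonneg_right this (by linarith)
      linarith) (by
      rw [hVn]
      have h1 : γ ^ 2 / 4 * (8 * m) =
          2 * (d * Real.log (d * (γ ^ 2)⁻¹) + Real.log n) := by
        rw [hm]; field_simp; ring
      have h2 : γ ^ 2 / 4 * (8 * m) ≤ γ ^ 2 / 4 * N :=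
        mul_le_mul_of_nonneg_left hN8 (by positivity)
      have h3 := mul_le_mul_of_nonneg_left hlog2 (Nat.cast_nonneg (α := ℝ) d)
      have h4 : 0 ≤ d * Real.log (d * (γ ^ 2)⁻¹) := by positivity
      linarith)
  have hbudget := vertexBudget_le (N := N) (x := c) hℓ18 hW hsize hN9 (by
    rw [hℓdef]; push_cast; linarith)
  obtain ⟨Ls, S, h1, h2, X, hX, hXc⟩ := hlink.exists_isTypeIAbsorber (by omega) hH hf K hKd hKcov
    (fun p hp => by
      have := hKX p hp
      simpa using this) (by
      rw [hKc]
      have : (Nat.card (Arc H) : ℝ) ≤ N := by linarith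
      exact_mod_cast this) (by
      rw [hKc]
      refine Nat.le_floor (hbudget.trans (le_trans ?_ hνn))
      have := mul_nonneg (show 0 ≤ m by linarith) (sq_nonneg c)
      linarith)
  refine ⟨K, Ls, S, h1, h2, X, hX, ?_⟩
  rw [hKc] at hXc
  have h3 : (X.card : ℝ) ≤ 40 * m * c ^ 2 := le_trans (by exact_mod_cast hXc) hbudget
  have h4 : absorberBound n d ν γ = 1600 * m * c ^ 2 + 3 * c ^ 2 * d := by
    rw [absorberBound, hm, hc, inv_pow]; ring
  rw [h4]
  have h5 : 0 ≤ m * c ^ 2 := mul_nonneg (by linarith) (sq_nonneg c)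
  have h6 : 0 ≤ 3 * c ^ 2 * d := by positivity
  linarith

/-! ### Disjoint copies -/

/-- The disjoint union of `k` copies of `H`. -/
def copies {W : Type v} (k : ℕ) (H : Digraph W) : Digraph (Fin k × W) where
  Adj p q := p.1 = q.1 ∧ H.Adj p.2 q.2

/-- The arc of the `i`-th copy that corresponds to the arc `e`. -/
def copyArc {W : Type v} {k : ℕ} {H : Digraph W} (i : Fin k) (e : Arc H) : Arc (copies k H) :=
  ⟨((i, e.1.1), (i, e.1.2)), rfl, e.2⟩

theorem copyArc_injective {W : Type v} {k : ℕ} {H : Digraph W} {i j : Fin k} {e e' : Arc H}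
    (h : copyArc i e = copyArc j e') : i = j ∧ e = e' := by
  have h' := congrArg Subtype.val h
  simp only [copyArc, Prod.mk.injEq] at h'
  exact ⟨h'.1.1, Subtype.ext (Prod.ext h'.1.2 h'.2.2)⟩

theorem exists_copyArc {W : Type v} {k : ℕ} {H : Digraph W} (e : Arc (copies k H)) :
    ∃ i e', e = copyArc i e' := by
  obtain ⟨⟨⟨i, x⟩, ⟨j, y⟩⟩, hij, hxy⟩ := e
  obtain rfl : i = j := hij
  exact ⟨i, ⟨(x, y), hxy⟩, rfl⟩

theorem card_arc_copies {W : Type v} (k : ℕ) (H : Digraph W) :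
    Nat.card (Arc (copies k H)) = k * Nat.card (Arc H) := by
  have : Function.Bijective (fun p : Fin k × Arc H => copyArc p.1 p.2) := by
    refine ⟨fun p q h => ?_, fun e => ?_⟩
    · exact Prod.ext (copyArc_injective h).1 (copyArc_injective h).2
    · obtain ⟨i, e', rfl⟩ := exists_copyArc e
      exact ⟨(i, e'), rfl⟩
  rw [← Nat.card_eq_of_bijective _ this, Nat.card_prod, Nat.card_fin]

namespace Subdivision

variable {V : Type u} {W : Type v} {D : Digraph V} {H : Digraph W} {k : ℕ}

/-- The `i`-th copy in a subdivision of `k` disjoint copies of `H`. -/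
def copy (S : Subdivision (copies k H) D) (i : Fin k) : Subdivision H D where
  branch w := S.branch (i, w)
  branch_injective := fun w w' h => (Prod.mk.inj (S.branch_injective h)).2
  path e := S.path (copyArc i e)
  isPath e := S.isPath (copyArc i e)
  branch_mem := fun e w h => by
    rcases S.branch_mem _ _ h with h | h
    · exact .inl (Prod.mk.inj h).2
    · exact .inr (Prod.mk.inj h).2
  disjoint := fun e e' hee' x hx hx' => by
    obtain ⟨w, rfl⟩ := S.disjoint _ _ (fun h => hee' (copyArc_injective h).2) x hx hx'
    rcases S.branch_mem _ _ hx with rfl | rfl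
    · exact ⟨_, rfl⟩
    · exact ⟨_, rfl⟩

theorem fst_eq_of_branch_mem_copy {S : Subdivision (copies k H) D} {i : Fin k} {w : Fin k × W}
    (h : S.branch w ∈ (S.copy i).verts) : w.1 = i := by
  rcases h with ⟨w', h⟩ | ⟨e, h⟩
  · rw [← S.branch_injective h]
  · rcases S.branch_mem _ _ h with rfl | rfl <;> rfl

theorem disjoint_verts_copy (S : Subdivision (copies k H) D) {i j : Fin k} (hij : i ≠ j) :
    Disjoint (S.copy i).verts (S.copy j).verts := by
  rw [Set.disjoint_left]
  intro x hx hx'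
  -- A common vertex would be a branch vertex, which determines its copy.
  obtain ⟨w, rfl⟩ : ∃ w, S.branch w = x := by
    rcases hx with ⟨w, rfl⟩ | ⟨e, hx⟩
    · exact ⟨_, rfl⟩
    · rcases hx' with ⟨w, rfl⟩ | ⟨e', hx'⟩
      · exact ⟨_, rfl⟩
      · exact S.disjoint _ _ (fun h => hij (copyArc_injective h).1) x hx hx'
  exact hij ((fst_eq_of_branch_mem_copy hx).symm.trans (fst_eq_of_branch_mem_copy hx'))

theorem copy_injective [Nonempty W] (S : Subdivision (copies k H) D) :
    Function.Injective S.copy := by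
  intro i j h
  obtain ⟨w⟩ := ‹Nonempty W›
  have : S.branch (i, w) = S.branch (j, w) := congrArg (fun T => T.branch w) h
  exact (Prod.mk.inj (S.branch_injective this)).1

theorem verts_copy_subset (S : Subdivision (copies k H) D) (i : Fin k) :
    (S.copy i).verts ⊆ S.verts := by
  rintro x (⟨w, rfl⟩ | ⟨e, hx⟩)
  · exact .inl ⟨_, rfl⟩
  · exact .inr ⟨_, hx⟩

end Subdivision

/-- A Type-I absorber for `k` disjoint copies of `H` is a Type-II absorber for `H` with `k`
subdivisions. -/
theorem IsTypeIAbsorber.isTypeIIAbsorber {V : Type u} {W : Type v} {D : Digraph V}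
    {H : Digraph W} {k d : ℕ} [Nonempty (Arc H)] {K : Set (V × V)} {Ls : Set (Ladder D)}
    {S : Subdivision (copies k H) D} (h : IsTypeIAbsorber d K Ls S) :
    IsTypeIIAbsorber d K Ls (Set.range S.copy) where
  base := h.base
  subdivisions_disjoint := by
    rintro _ ⟨i, rfl⟩ _ ⟨j, rfl⟩ hij
    exact S.disjoint_verts_copy fun e => hij (by rw [e])
  embedded := by
    intro L hL
    obtain ⟨e, he⟩ := h.embedded L hL
    obtain ⟨i, e', rfl⟩ := exists_copyArc e
    exact ⟨_, ⟨i, rfl⟩, e', he⟩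
  has_ladder := by
    rintro _ ⟨i, rfl⟩
    obtain ⟨e⟩ := ‹Nonempty (Arc H)›
    obtain ⟨L, hL, hLe⟩ := h.path_has_ladder (copyArc i e)
    exact ⟨L, hL, e, hLe⟩

end HLinkage

theorem lemma2p12 {V : Type u} [Fintype V] {W : Type v} [Fintype W] [Nonempty W]
    (H : Digraph W) (hH : HLinkage.Loopless H) (hHiso : HLinkage.NoIsolatedVertices H)
    (D : Digraph V) (hD : HLinkage.Loopless D)
    (ν τ γ : ℝ) (n d : ℕ)
    (hν : 0 < ν) (hντ : ν ≤ τ) (hτγ : τ ≤ γ / 16) (hγ : γ / 16 < 1 / 16)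
    (hd : 8 ≤ d)
    (hn : max (10 ^ 4 * (d : ℝ) ^ 2 * (γ ^ 5)⁻¹ * Real.log (100 * d * (γ ^ 2)⁻¹) ^ 2)
        (10 ^ 5 * (d : ℝ) * (γ ^ 2)⁻¹ * (ν ^ 3)⁻¹ * Real.log (1500 * d * (γ ^ 2)⁻¹ * ν⁻¹))
      < (n : ℝ))
    (hVn : Fintype.card V = n)
    (hrob : HLinkage.IsRobustExpander D ν τ)
    (hdeg : γ * n ≤ HLinkage.minSemidegree D)
    (hsize : (Nat.card (HLinkage.Arc H) : ℝ) ≤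
      (γ ^ 2)⁻¹ * (d * Real.log (d * (γ ^ 2)⁻¹) + Real.log n)) :
    (∀ f : W → V, Function.Injective f →
      ∃ (K : Set (V × V)) (Ls : Set (HLinkage.Ladder D)) (S : HLinkage.Subdivision H D),
        HLinkage.IsTypeIAbsorber d K Ls S ∧ S.branch = f ∧
        ((HLinkage.absorberVerts K Ls {S}).ncard : ℝ) ≤ HLinkage.absorberBound n d ν γ) ∧
    (∀ k : ℕ, 1 ≤ k →
      (k : ℝ) * Nat.card (HLinkage.Arc H) ≤
        (γ ^ 2)⁻¹ * (d * Real.log (d * (γ ^ 2)⁻¹) + Real.log n) →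
      ∃ (K : Set (V × V)) (Ls : Set (HLinkage.Ladder D)) (Hs : Set (HLinkage.Subdivision H D)),
        HLinkage.IsTypeIIAbsorber d K Ls Hs ∧ Hs.ncard = k ∧
        ((HLinkage.absorberVerts K Ls Hs).ncard : ℝ) ≤ HLinkage.absorberBound n d ν γ) := by
  have hγ0 : 0 < γ := by linarith
  have hγ1 : γ ≤ 1 := by linarith
  have hVn' : Nat.card V = n := by rw [Nat.card_eq_fintype_card, hVn]
  have hmn := HLinkage.size_le_of_lt hν (by linarith) hγ0 hγ1 hd
    (lt_of_le_of_lt (le_max_right _ _) hn)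
  have hncard : ∀ (s : Set V) (X : Finset V) (r : ℝ), s ⊆ X → (X.card : ℝ) ≤ r →
      (s.ncard : ℝ) ≤ r := by
    intro s X r h1 h2
    refine le_trans ?_ h2
    have := Set.ncard_le_ncard h1 X.finite_toSet
    rw [Set.ncard_coe_finset] at this
    exact_mod_cast this
  refine ⟨fun f hf => ?_, fun k hk hksize => ?_⟩
  · obtain ⟨K, Ls, S, h1, h2, X, hX, hXc⟩ := HLinkage.IsRobustExpander.exists_isTypeIAbsorber hH
      hHiso hν hντ hτγ hγ1 hd rfl hmn hVn' hrob hdeg hsize hf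
    exact ⟨K, Ls, S, h1, h2, hncard _ X _ hX hXc⟩
  · have hcH : HLinkage.Loopless (HLinkage.copies k H) := fun x hx => hH _ hx.2
    have hciso : HLinkage.NoIsolatedVertices (HLinkage.copies k H) := by
      rintro ⟨i, x⟩
      obtain ⟨y, hy⟩ := hHiso x
      exact ⟨(i, y), hy.imp (fun h => ⟨rfl, h⟩) fun h => ⟨rfl, h⟩⟩
    have : Nonempty (Fin k) := ⟨⟨0, hk⟩⟩
    have hArc : Nonempty (HLinkage.Arc H) := by
      obtain ⟨w⟩ := ‹Nonempty W›
      obtain ⟨y, hy | hy⟩ := hHiso w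
      exacts [⟨⟨(w, y), hy⟩⟩, ⟨⟨(y, w), hy⟩⟩]
    have hcsize : (Nat.card (HLinkage.Arc (HLinkage.copies k H)) : ℝ) ≤
        (γ ^ 2)⁻¹ * (d * Real.log (d * (γ ^ 2)⁻¹) + Real.log n) := by
      rw [HLinkage.card_arc_copies]; push_cast; exact hksize
    obtain ⟨f⟩ : Nonempty (Fin k × W ↪ V) := by
      apply Function.Embedding.nonempty_of_card_le
      rw [← Nat.card_eq_fintype_card, hVn]
      have h1 : (Nat.card (Fin k × W) : ℝ) ≤
          2 * Nat.card (HLinkage.Arc (HLinkage.copies k H)) := by exact_mod_cast hciso.card_le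
      have h2 : 1 ≤ (ν ^ 3)⁻¹ :=
        (one_le_inv₀ (by positivity)).mpr (pow_le_one₀ hν.le (by linarith))
      have h3 : (0 : ℝ) ≤ Nat.card (HLinkage.Arc (HLinkage.copies k H)) := Nat.cast_nonneg _
      have h4 : (Nat.card (Fin k × W) : ℝ) ≤ n := by nlinarith
      exact_mod_cast h4
    obtain ⟨K, Ls, S, h1, -, X, hX, hXc⟩ := HLinkage.IsRobustExpander.exists_isTypeIAbsorber hcH
      hciso hν hντ hτγ hγ1 hd rfl hmn hVn' hrob hdeg hcsize f.injective
    refine ⟨K, Ls, Set.range S.copy, h1.isTypeIIAbsorber, ?_, hncard _ X _ ?_ hXc⟩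
    · rw [← Set.image_univ, Set.ncard_image_of_injective _ S.copy_injective, Set.ncard_univ,
        Nat.card_fin]
    · refine subset_trans (Set.union_subset_union_right _ ?_) hX
      intro x hx
      simp only [Set.mem_iUnion] at hx ⊢
      obtain ⟨_, ⟨i, rfl⟩, hx⟩ := hx
      exact ⟨S, rfl, S.verts_copy_subset i hx⟩
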